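/- A standard probability space is a standard Borel space with a probability measure, and an automorphism $T$ of $(X,\mathcal B,\mu)$ is a $\mu$-preserving bijection, measurable with measurable inverse. A joining of $(X,\mathcal B,\mu,T)$ and $(Y,\mathcal C,\nu,S)$ is a $T\times S$-invariant measure on $\mathcal B\otimes\mathcal C$ with marginals $\mu$ and $\nu$; the two systems are disjoint if $\mu\otimes\nu$ is their only joining. $T$ is mixing if $\mu(A\cap T^{-n}B)\to\mu(A)\mu(B)$ as $n\to\infty$ for all $A,B\in\mathcal B$. A factor of $T$ is a $\sigma$-algebra $\mathcal A\subset\mathcal B$ with $T^{-1}\mathcal A=\mathcal A$; it is regarded as the system $(X,\mathcal A,\mu|_{\mathcal A},T)$, and it is nontrivial if it contains a set $A$ with $0<\mu(A)<1$. **Theorem.** Let $T$ be an automorphism of a standard probability space $(X,\mathcal B,\mu)$. 1. Let $\lambda$ be a self-joining of $T$ that is the weak limit of the graph joinings of powers $T^{k_j}$, where $k_j\in\mathbb Z$ and $|k_j|\to\infty$; that is, $\lambda(A\times B)=\lim_{j}\mu(A\cap T^{-k_j}B)$ for all $A,B\in\mathcal B$. Let $V:L^2(X,\mu)\to L^2(X,\mu)$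 be the Markov operator of $\lambda$, defined by $\int (Vf)\,g\,d\mu=\int f(x)g(y)\,d\lambda(x,y)$, and let $\mathcal A$ be the $\sigma$-algebra generated, modulo $\mu$-null sets, by the functions $Vf$, $f\in L^2(X,\mu)$ (the factor generated by $\lambda$). Then $\mathcal A$ is a factor of $T$, and it is disjoint from every mixing automorphism of a standard probability space. 2. In particular, if $T$ is not mixing, then $T$ has a nontrivial factor that is disjoint from every mixing automorphism of a standard probability space. -/

import Mathlib

open MeasureTheory Filter Topology

universe u v

namespace Joinings

section Systems

variable {X Y : Type*} [MeasurableSpace X] [MeasurableSpace Y]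

/-- `ρ` is a joining (coupling) of the systems `(X, μ, T)` and `(Y, ν, S)`: a measure on the
product `σ`-algebra, with marginals `μ` and `ν`, that is invariant under `T × S`. -/
structure IsJoining (μ : Measure X) (T : X → X) (ν : Measure Y) (S : Y → Y)
    (ρ : Measure (X × Y)) : Prop where
  fst : MeasurePreserving Prod.fst ρ μ
  snd : MeasurePreserving Prod.snd ρ ν
  invariant : MeasurePreserving (Prod.map T S) ρ ρ

/-- Two systems are disjoint if the product measure is their only joining. -/
def AreDisjoint (μ : Measure X) (T : X → X) (ν : Measure Y) (S : Y → Y) : Prop :=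
  ∀ ρ : Measure (X × Y), IsJoining μ T ν S ρ → ρ = μ.prod ν

/-- Mixing: `μ (A ∩ T⁻ⁿ B) → μ A * μ B` as `n → ∞`, for all measurable sets `A` and `B`. -/
def IsMixing (μ : Measure X) (T : X → X) : Prop :=
  ∀ A B : Set X, MeasurableSet A → MeasurableSet B →
    Tendsto (fun n : ℕ => μ (A ∩ T^[n] ⁻¹' B)) atTop (𝓝 (μ A * μ B))

/-- The Markov operator `V : L²(X, μ) → L²(Y, ν)` of a joining `ρ`: lift a function from `X` to
`X × Y`, then project orthogonally onto the functions of the second coordinate (the adjoint of the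
lift from `Y`). In other words `⟪V f, g⟫ = ∫ f(x) g(y) dρ(x, y)`. -/
noncomputable def markovOperator {μ : Measure X} {T : X → X} {ν : Measure Y} {S : Y → Y}
    {ρ : Measure (X × Y)} (h : IsJoining μ T ν S ρ) : Lp ℝ 2 μ →L[ℝ] Lp ℝ 2 ν :=
  (ContinuousLinearMap.adjoint
      (Lp.compMeasurePreservingₗᵢ ℝ Prod.snd h.snd :
        Lp ℝ 2 ν →ₗᵢ[ℝ] Lp ℝ 2 ρ).toContinuousLinearMap).comp
    (Lp.compMeasurePreservingₗᵢ ℝ Prod.fst h.fst :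
      Lp ℝ 2 μ →ₗᵢ[ℝ] Lp ℝ 2 ρ).toContinuousLinearMap

theorem inner_markovOperator {μ : Measure X} {T : X → X} {ν : Measure Y} {S : Y → Y}
    {ρ : Measure (X × Y)} (h : IsJoining μ T ν S ρ) (f : Lp ℝ 2 μ) (g : Lp ℝ 2 ν) :
    inner ℝ (markovOperator h f) g = ∫ p, f p.1 * g p.2 ∂ρ := by
  rw [markovOperator, ContinuousLinearMap.comp_apply, ContinuousLinearMap.adjoint_inner_left,
    L2.inner_def]
  apply integral_congr_ae
  filter_upwards [Lp.coeFn_compMeasurePreserving f h.fst,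
    Lp.coeFn_compMeasurePreserving g h.snd] with p hf hg
  change inner ℝ (Lp.compMeasurePreserving Prod.fst h.fst f p)
    (Lp.compMeasurePreserving Prod.snd h.snd g p) = _
  rw [hf, hg]
  simp [mul_comm]

/-- The `σ`-algebra on `Y` generated, modulo `ν`-null sets, by the image of an operator
`V : L²(X, μ) → L²(Y, ν)`: it is generated by the measurable sets that are almost everywhere equal
to a set `{V f ∈ s}` with `f ∈ L²(X, μ)` and `s` a Borel set of reals. The choice `s = ∅` puts all
measurable null sets into it. -/
@[reducible]
def imageSigmaAlgebra {μ : Measure X} {ν : Measure Y} (V : Lp ℝ 2 μ →L[ℝ] Lp ℝ 2 ν) :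
    MeasurableSpace Y :=
  MeasurableSpace.generateFrom
    {B | MeasurableSet B ∧ ∃ (f : Lp ℝ 2 μ) (s : Set ℝ), MeasurableSet s ∧
      B =ᵐ[ν] (fun y => V f y) ⁻¹' s}

/-- The factor of `Y` generated by a joining `ρ` of `X` and `Y`. -/
@[reducible]
noncomputable def generatedFactor {μ : Measure X} {T : X → X} {ν : Measure Y} {S : Y → Y}
    {ρ : Measure (X × Y)} (h : IsJoining μ T ν S ρ) : MeasurableSpace Y :=
  imageSigmaAlgebra (markovOperator h)

/-- The power `T ^ k`, `k ∈ ℤ`, of a measurable bijection with measurable inverse. -/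
def zpow (T : X ≃ᵐ X) (k : ℤ) : X → X :=
  ((T.toEquiv : Equiv.Perm X) ^ k : Equiv.Perm X)

/-- The image of `μ` on the graph of `T ^ k`. -/
noncomputable def graphJoining (μ : Measure X) (T : X ≃ᵐ X) (k : ℤ) : Measure (X × X) :=
  μ.map (fun x => (x, zpow T k x))

theorem measurable_zpow (T : X ≃ᵐ X) (k : ℤ) : Measurable (zpow T k) := by
  have key : ∀ (e : Equiv.Perm X), Measurable e → ∀ n : ℕ, Measurable (e ^ n : Equiv.Perm X) := by
    intro e he n
    rw [Equiv.Perm.coe_pow]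
    exact he.iterate n
  rcases k with n | n
  · simpa [zpow] using key _ T.measurable n
  · have := key (T.toEquiv : Equiv.Perm X)⁻¹ T.symm.measurable (n + 1)
    simpa [zpow, zpow_negSucc, inv_pow] using this

theorem graphJoining_prod (μ : Measure X) (T : X ≃ᵐ X) (k : ℤ) {A B : Set X}
    (hA : MeasurableSet A) (hB : MeasurableSet B) :
    graphJoining μ T k (A ×ˢ B) = μ (A ∩ zpow T k ⁻¹' B) := by
  have h : Measurable (fun x => (x, zpow T k x)) := measurable_id.prodMk (measurable_zpow T k)
  rw [graphJoining, Measure.map_apply h (hA.prod hB)]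
  rfl

/-- Weak convergence of measures on `X × X` in the space of joinings: convergence on all measurable
rectangles. -/
def WeakLimit (ρs : ℕ → Measure (X × X)) (ρ : Measure (X × X)) : Prop :=
  ∀ A B : Set X, MeasurableSet A → MeasurableSet B →
    Tendsto (fun j => ρs j (A ×ˢ B)) atTop (𝓝 (ρ (A ×ˢ B)))

end Systems

/-- `m` is a factor of the automorphism `T` of `(X, mX)`: a sub-`σ`-algebra with `T⁻¹ m = m`. -/
structure IsFactor {X : Type*} {mX : MeasurableSpace X} (T : X ≃ᵐ X) (m : MeasurableSpace X) :
    Prop where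
  le : m ≤ mX
  invariant : ∀ A : Set X, MeasurableSet[m] (T ⁻¹' A) ↔ MeasurableSet[m] A

/-- The factor `m` of `(X, μ, T)`, i.e. the system given by `T` on `X` with the `σ`-algebra `m` and
the restriction of `μ` to `m`, is disjoint from every mixing automorphism of a standard
probability space. -/
def DisjointFromMixing {X : Type u} {mX : MeasurableSpace X} (μ : Measure X) (T : X ≃ᵐ X)
    (m : MeasurableSpace X) (hm : IsFactor T m) : Prop :=
  ∀ (Y : Type v) [MeasurableSpace Y] [StandardBorelSpace Y] (ν : Measure Y)
    [IsProbabilityMeasure ν] (S : Y ≃ᵐ Y), MeasurePreserving S ν ν → IsMixing ν S →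
      @AreDisjoint X Y m _ (μ.trim hm.le) T ν S

end Joinings

/-!
Let `V` be a weak limit of powers `f ↦ f ∘ T ^ n` of the Koopman operator, `n` running through an
ultrafilter finer than the cofinite filter on `ℤ`. The Markov operator of a limit of graph joinings
is of this form (`exists_isKoopmanLimit_markovOperator`), and if `T` is not mixing there is such a
`V` whose image is not contained in the constants (`exists_isKoopmanLimit_nontrivial`). The operator
`V` commutes with `T`, so the `σ`-algebra generated by its image is a factor.

Let `Y` be mixing and joined with this factor. By Mazur's theorem a function `f = V h` is
*recurrent*: it is a limit in mean square of convex combinations of translates of `h` by large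
powers of `T`. Hence `f` is orthogonal to every function whose translates tend weakly to `0`, in
every extension of the system, and in particular to the centred functions of `Y`. To reach the
`σ`-algebra generated by the functions `V h`, one has to show that a *product* of recurrent
functions `f₁ ⋯ fₘ` is uncorrelated with every centred function `g` of `Y`. This is
`AlgSystem.integral_prod_recurrent_eq_zero`, and is proved by induction on `m`. The claim is
strengthened to products `f₁ ⋯ fₘ c g` with `c` from a family `C` independent of `Y`. For the
induction step it suffices that the translates of `G = f₂ ⋯ fₘ c g` tend weakly to `0`, that is,
that `∫ h (G ∘ T ^ n) → 0` along every nonprincipal ultrafilter, for every `h`. This limit is the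
integral of `h(z) G(z')` in the system of pairs `(z, z')`, whose invariant integral is the limit of
the graph self-joinings along the ultrafilter. There the functions `h(z) c(z')` form a family
independent of the mixing functions `g(z')`, because the translates of `c g` tend weakly to `0` by
van der Corput's inequality; so the induction hypothesis, applied in the system of pairs, shows that
the limit vanishes.

The limit systems are needed only as positive invariant functionals on commutative algebras
(`AlgSystem`), so no compactness of the space of joinings has to be used: the algebra of the system
of pairs is a tensor square.

Finally, measures with equal mixed moments agree on the `σ`-algebra generated by the functions
involved (`measure_eq_of_mixed_moments_eq`), which turns the vanishing of these correlations into
independence.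
-/

open scoped TensorProduct

namespace Joinings

/-! ### Algebraic systems -/

/-- A commutative algebra with an action of `ℤ` by endomorphisms and an invariant positive linear
functional. The algebra plays the role of an algebra of bounded functions on a space on which only
a finitely additive invariant integral is available, so that limits of systems along ultrafilters
are again systems. -/
structure AlgSystem (𝒜 : Type*) [CommRing 𝒜] [Algebra ℝ 𝒜] where
  /-- The action of `ℤ`. -/
  act : ℤ → 𝒜 →ₐ[ℝ] 𝒜
  /-- The invariant integral. -/
  integral : 𝒜 →ₗ[ℝ] ℝ
  act_zero : ∀ a, act 0 a = a
  act_add : ∀ m n a, act (m + n) a = act m (act n a)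
  integral_act : ∀ n a, integral (act n a) = integral a
  integral_sq_nonneg : ∀ a, 0 ≤ integral (a * a)

namespace AlgSystem

variable {𝒜 : Type*} [CommRing 𝒜] [Algebra ℝ 𝒜]

theorem integral_mul_sq_le (Z : AlgSystem 𝒜) (a b : 𝒜) :
    Z.integral (a * b) ^ 2 ≤ Z.integral (a * a) * Z.integral (b * b) := by
  have key : ∀ t : ℝ, 0 ≤ Z.integral (b * b) * (t * t) + 2 * Z.integral (a * b) * t
      + Z.integral (a * a) := by
    intro t
    have h := Z.integral_sq_nonneg (a + t • b)
    have e : (a + t • b) * (a + t • b) = (t * t) • (b * b) + (2 * t) • (a * b) + a * a := by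
      simp only [Algebra.smul_def, map_mul]
      rw [map_ofNat]
      ring
    rw [e] at h
    simp only [map_add, map_smul, smul_eq_mul] at h
    linarith
  have := discrim_le_zero key
  simp only [discrim] at this
  nlinarith

theorem abs_integral_mul_le (Z : AlgSystem 𝒜) (a b : 𝒜) :
    |Z.integral (a * b)| ≤ √(Z.integral (a * a) * Z.integral (b * b)) :=
  Real.abs_le_sqrt (Z.integral_mul_sq_le a b)

theorem integral_act_mul_act (Z : AlgSystem 𝒜) (n m : ℤ) (a b : 𝒜) :
    Z.integral (Z.act n a * Z.act m b) = Z.integral (a * Z.act (m - n) b) := by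
  conv_lhs => rw [show m = n + (m - n) by ring, Z.act_add, ← map_mul, Z.integral_act]

theorem abs_integral_mul_act_le (Z : AlgSystem 𝒜) (m : ℤ) (a b : 𝒜) :
    |Z.integral (a * Z.act m b)| ≤ √(Z.integral (a * a) * Z.integral (b * b)) := by
  refine (Z.abs_integral_mul_le _ _).trans_eq ?_
  rw [← map_mul (Z.act m), Z.integral_act]

end AlgSystem

/-- A pointwise bounded family of linear functionals has a pointwise limit along any ultrafilter,
and it is linear. -/
theorem exists_linearMap_tendsto_ultrafilter {ι E : Type*} [AddCommGroup E] [Module ℝ E]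
    (p : Ultrafilter ι) (L : ι → E →ₗ[ℝ] ℝ) (hL : ∀ e, ∃ C, ∀ i, |L i e| ≤ C) :
    ∃ l : E →ₗ[ℝ] ℝ, ∀ e, Tendsto (fun i => L i e) p (𝓝 (l e)) := by
  have h : ∀ e, ∃ x, Tendsto (fun i => L i e) p (𝓝 x) := by
    intro e
    obtain ⟨C, hC⟩ := hL e
    obtain ⟨x, -, hx⟩ := isCompact_Icc.ultrafilter_le_nhds (p.map fun i => L i e)
      (s := Set.Icc (-C) C) (by
        rw [Ultrafilter.coe_map, le_principal_iff]
        exact Filter.mem_map.2 (Filter.univ_mem' fun i => abs_le.1 (hC i)))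
    exact ⟨x, hx⟩
  choose l hl using h
  refine ⟨{ toFun := l, map_add' := fun a b => ?_, map_smul' := fun r a => ?_ }, hl⟩
  · refine tendsto_nhds_unique (hl (a + b)) ?_
    simpa only [map_add] using (hl a).add (hl b)
  · refine tendsto_nhds_unique (hl (r • a)) ?_
    simpa only [map_smul, RingHom.id_apply] using (hl a).const_smul r

/-- The van der Corput principle: if `u n` is bounded in norm and `⟨u n, u m⟩ → 0` as `n`, then `m`,
tend to infinity, then `⟨u n, v⟩ → 0`. -/
theorem AlgSystem.tendsto_zero_of_correlations {𝒜 : Type*} [CommRing 𝒜] [Algebra ℝ 𝒜]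
    (Z : AlgSystem 𝒜) {ι : Type*} (p : Ultrafilter ι) (u : ι → 𝒜) (M : ℝ)
    (hM : ∀ i, Z.integral (u i * u i) ≤ M)
    (hu : ∀ i, Tendsto (fun j => Z.integral (u j * u i)) p (𝓝 0)) (v : 𝒜) :
    Tendsto (fun j => Z.integral (u j * v)) p (𝓝 0) := by
  obtain ⟨l, hl⟩ := exists_linearMap_tendsto_ultrafilter p
    (fun i => Z.integral ∘ₗ LinearMap.mulLeft ℝ (u i)) (by
      intro e
      refine ⟨√(M * Z.integral (e * e)), fun i => (Z.abs_integral_mul_le _ _).trans ?_⟩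
      exact Real.sqrt_le_sqrt (mul_le_mul_of_nonneg_right (hM i) (Z.integral_sq_nonneg e)))
  simp only [LinearMap.comp_apply, LinearMap.mulLeft_apply] at hl
  have hlu : ∀ i, l (u i) = 0 := fun i => tendsto_nhds_unique (hl (u i)) (hu i)
  suffices h0 : l v = 0 by simpa [h0] using hl v
  by_contra hc
  have hε : 0 < |l v| / 2 := by positivity
  -- Sums of `N` nearly orthogonal vectors `u i` whose inner products with `v` are nearly `l v`.
  have key : ∀ N : ℕ, ∃ w, l w = 0 ∧ |Z.integral (w * v) - N * l v| ≤ N * (|l v| / 2) ∧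
      Z.integral (w * w) ≤ N * (M + 2) := by
    intro N
    induction N with
    | zero => exact ⟨0, by simp⟩
    | succ N ih =>
      obtain ⟨w, hw0, hw1, hw2⟩ := ih
      have e1 : ∀ᶠ i in p, |Z.integral (u i * w)| < 1 := by
        have := (hl w).abs
        rw [hw0, abs_zero] at this
        exact this.eventually_lt_const one_pos
      have e2 : ∀ᶠ i in p, |Z.integral (u i * v) - l v| < |l v| / 2 := by
        have := ((hl v).sub_const (l v)).abs
        rw [sub_self, abs_zero] at this
        exact this.eventually_lt_const hε
      obtain ⟨i, h1, h2⟩ := (e1.and e2).exists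
      refine ⟨w + u i, by rw [map_add, hw0, hlu, add_zero], ?_, ?_⟩
      · have : Z.integral ((w + u i) * v) - (N + 1 : ℕ) * l v
            = (Z.integral (w * v) - N * l v) + (Z.integral (u i * v) - l v) := by
          rw [add_mul, map_add]; push_cast; ring
        rw [this]
        refine (abs_add_le _ _).trans ?_
        push_cast
        linarith
      · have : (w + u i) * (w + u i) = w * w + (2 : ℝ) • (u i * w) + u i * u i := by
          rw [Algebra.smul_def, map_ofNat]; ring
        rw [this]
        simp only [map_add, map_smul, smul_eq_mul]
        have := hM i
        have := (abs_lt.1 h1).2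
        push_cast
        linarith
  obtain ⟨N, hN⟩ := exists_nat_gt ((M + 2) * Z.integral (v * v) / (|l v| / 2) ^ 2)
  rw [div_lt_iff₀ (by positivity)] at hN
  have hV := Z.integral_sq_nonneg v
  rcases Nat.eq_zero_or_pos N with rfl | hNpos
  · obtain ⟨w, -, -, hw⟩ := key 1
    have := Z.integral_sq_nonneg w
    push_cast at hw hN
    nlinarith
  · have hN0 : (0 : ℝ) < N := by exact_mod_cast hNpos
    obtain ⟨w, -, h1, h2⟩ := key N
    have hlow : N * (|l v| / 2) ≤ |Z.integral (w * v)| := by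
      have := abs_sub_abs_le_abs_sub (N * l v) (Z.integral (w * v))
      rw [abs_sub_comm, abs_mul, abs_of_pos hN0] at this
      linarith
    have hcs := Z.integral_mul_sq_le w v
    rw [← sq_abs] at hcs
    have h3 : (N * (|l v| / 2)) ^ 2 ≤ N * (M + 2) * Z.integral (v * v) :=
      (pow_le_pow_left₀ (by positivity) hlow 2).trans
        (hcs.trans (mul_le_mul_of_nonneg_right h2 hV))
    have h4 : N * ((M + 2) * Z.integral (v * v)) < N * (N * (|l v| / 2) ^ 2) :=
      mul_lt_mul_of_pos_left hN hN0
    nlinarith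

/-! ### The limit system along an ultrafilter -/

/-- The pull-back to the graph of the `n`-th iterate: `a ⊗ b ↦ a * act n b`. -/
noncomputable def AlgSystem.graphHom {𝒜 : Type*} [CommRing 𝒜] [Algebra ℝ 𝒜] (Z : AlgSystem 𝒜)
    (n : ℤ) : 𝒜 ⊗[ℝ] 𝒜 →ₐ[ℝ] 𝒜 :=
  Algebra.TensorProduct.lift (AlgHom.id ℝ 𝒜) (Z.act n) fun _ _ => Commute.all _ _

@[simp]
theorem AlgSystem.graphHom_tmul {𝒜 : Type*} [CommRing 𝒜] [Algebra ℝ 𝒜] (Z : AlgSystem 𝒜)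
    (n : ℤ) (a b : 𝒜) : Z.graphHom n (a ⊗ₜ b) = a * Z.act n b := by
  simp [AlgSystem.graphHom]

/-- The limit of the graph self-joinings of a system along an ultrafilter `p`: a system on `𝒜 ⊗ 𝒜`
with integral `a ⊗ b ↦ lim_p ∫ a * act n b`. -/
theorem AlgSystem.exists_graphLimit {𝒜 : Type*} [CommRing 𝒜] [Algebra ℝ 𝒜] (Z : AlgSystem 𝒜)
    (p : Ultrafilter ℤ) :
    ∃ Z' : AlgSystem (𝒜 ⊗[ℝ] 𝒜),
      (∀ n a b, Z'.act n (a ⊗ₜ b) = Z.act n a ⊗ₜ Z.act n b) ∧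
      ∀ a b, Tendsto (fun n => Z.integral (a * Z.act n b)) p (𝓝 (Z'.integral (a ⊗ₜ b))) := by
  obtain ⟨l, hl⟩ := exists_linearMap_tendsto_ultrafilter p
    (fun n => Z.integral ∘ₗ (Z.graphHom n).toLinearMap) (by
      intro e
      induction e using TensorProduct.induction_on with
      | zero => exact ⟨0, by simp⟩
      | tmul a b =>
        exact ⟨_, fun n => by simpa using Z.abs_integral_mul_act_le n a b⟩
      | add x y hx hy =>
        obtain ⟨C, hC⟩ := hx
        obtain ⟨D, hD⟩ := hy
        exact ⟨C + D, fun i => by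
          rw [map_add]; exact (abs_add_le _ _).trans (add_le_add (hC i) (hD i))⟩)
  simp only [LinearMap.comp_apply, AlgHom.toLinearMap_apply] at hl
  refine ⟨{ act := fun n => Algebra.TensorProduct.map (Z.act n) (Z.act n)
            integral := l
            act_zero := fun a => ?_
            act_add := fun m n a => ?_
            integral_act := fun m a => ?_
            integral_sq_nonneg := fun a => ?_ }, fun n a b => by simp, fun a b => by
              simpa using hl (a ⊗ₜ b)⟩
  · induction a using TensorProduct.induction_on with
    | zero => simp
    | tmul a b => simp [Z.act_zero]
    | add x y hx hy => rw [map_add, hx, hy]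
  · induction a using TensorProduct.induction_on with
    | zero => simp
    | tmul a b => simp [Z.act_add]
    | add x y hx hy => simp only [map_add, hx, hy]
  · refine tendsto_nhds_unique (hl _) ((hl a).congr fun n => ?_)
    have : Z.graphHom n (Algebra.TensorProduct.map (Z.act m) (Z.act m) a)
        = Z.act m (Z.graphHom n a) := by
      induction a using TensorProduct.induction_on with
      | zero => simp
      | tmul a b => simp [← Z.act_add, add_comm]
      | add x y hx hy => simp only [map_add, hx, hy]
    rw [this, Z.integral_act]
  · refine ge_of_tendsto' (hl _) fun n => ?_
    rw [map_mul]
    exact Z.integral_sq_nonneg _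

/-! ### Disjointness of recurrent elements and mixing elements -/

/-- `f` is recurrent if for some `h` it can be approximated in mean square by convex combinations of
translates `act n h` with arbitrarily large `|n|`. The elements of the form `V h`, for a weak limit
`V` of powers of the action, are of this form. -/
def AlgSystem.IsRecurrent {𝒜 : Type*} [CommRing 𝒜] [Algebra ℝ 𝒜] (Z : AlgSystem 𝒜) (f : 𝒜) :
    Prop :=
  ∃ h, ∀ K : Finset ℤ, ∀ ε > 0, ∃ w ∈ convexHull ℝ ((fun n => Z.act n h) '' (K : Set ℤ)ᶜ),
    Z.integral ((f - w) * (f - w)) < ε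

/-- In every extension `φ : 𝒜₀ → 𝒜` of the given system, a recurrent element `f` of `𝒜₀` is
orthogonal to all elements of `𝒜` whose translates tend weakly to zero. -/
theorem AlgSystem.integral_mul_eq_zero_of_isRecurrent {𝒜₀ 𝒜 : Type*} [CommRing 𝒜₀]
    [Algebra ℝ 𝒜₀] [CommRing 𝒜] [Algebra ℝ 𝒜] {Z₀ : AlgSystem 𝒜₀} {Z : AlgSystem 𝒜}
    {φ : 𝒜₀ →ₐ[ℝ] 𝒜} (hact : ∀ n a, φ (Z₀.act n a) = Z.act n (φ a))
    (hint : ∀ a, Z.integral (φ a) = Z₀.integral a) {f : 𝒜₀} (hf : Z₀.IsRecurrent f) {g : 𝒜}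
    (hg : ∀ h, Tendsto (fun n => Z.integral (h * Z.act n g)) cofinite (𝓝 0)) :
    Z.integral (φ f * g) = 0 := by
  obtain ⟨h, hh⟩ := hf
  refine abs_nonpos_iff.1 (le_of_forall_pos_le_add fun δ hδ => ?_)
  have hfin := eventually_cofinite.1 (((hg (φ h)).abs.congr fun _ => rfl).eventually_lt_const
    (show |(0 : ℝ)| < δ / 2 by simpa using half_pos hδ))
  set G := Z.integral (g * g)
  have hG : 0 ≤ G := Z.integral_sq_nonneg g
  obtain ⟨w, hw, hfw⟩ := hh (hfin.toFinset.image fun n => -n) ((δ / 2) ^ 2 / (G + 1))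
    (by positivity)
  have h1 : |Z.integral (φ w * g)| ≤ δ / 2 := by
    have hconv : Convex ℝ {w : 𝒜₀ | |Z.integral (φ w * g)| ≤ δ / 2} := by
      intro x hx y hy a b ha hb hab
      simp only [Set.mem_ofPred_eq] at hx hy ⊢
      simp only [map_add, map_smul, add_mul, smul_mul_assoc, smul_eq_mul]
      refine (abs_add_le _ _).trans ?_
      rw [abs_mul, abs_mul, abs_of_nonneg ha, abs_of_nonneg hb]
      calc _ ≤ a * (δ / 2) + b * (δ / 2) := by gcongr
        _ = δ / 2 := by rw [← add_mul, hab, one_mul]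
    refine convexHull_min ?_ hconv hw
    rintro _ ⟨n, hn, rfl⟩
    simp only [Set.mem_ofPred_eq]
    have e := Z.integral_act_mul_act n 0 (φ h) g
    rw [Z.act_zero, zero_sub] at e
    rw [hact, e]
    by_contra hlt
    refine hn ?_
    simp only [Finset.coe_image, Set.Finite.coe_toFinset]
    exact ⟨-n, fun h' => hlt h'.le, neg_neg n⟩
  have h2 : |Z.integral (φ (f - w) * g)| ≤ δ / 2 := by
    refine (Z.abs_integral_mul_le _ _).trans ?_
    rw [← map_mul φ, hint]
    refine Real.sqrt_le_iff.2 ⟨by positivity, ?_⟩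
    calc _ ≤ (δ / 2) ^ 2 / (G + 1) * G := by gcongr
      _ ≤ (δ / 2) ^ 2 := by
        rw [div_mul_eq_mul_div, div_le_iff₀ (by positivity)]
        nlinarith [sq_nonneg (δ / 2)]
  have h3 : Z.integral (φ f * g) = Z.integral (φ (f - w) * g) + Z.integral (φ w * g) := by
    rw [← map_add, ← add_mul, ← map_add, sub_add_cancel]
  rw [h3, zero_add]
  exact (abs_add_le _ _).trans (by linarith)

universe w

/-- If `C` is independent of the mixing family `φ 𝒟`, then the translates of `c * (φ d - ∫ d)`
tend weakly to zero. -/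
theorem AlgSystem.tendsto_integral_mul_act_centered {𝒜₀ 𝒜 : Type*} [CommRing 𝒜₀]
    [Algebra ℝ 𝒜₀] [CommRing 𝒜] [Algebra ℝ 𝒜] {Z₀ : AlgSystem 𝒜₀} {Z : AlgSystem 𝒜}
    {φ : 𝒜₀ →ₐ[ℝ] 𝒜} (hact : ∀ n a, φ (Z₀.act n a) = Z.act n (φ a))
    {𝒟 : Set 𝒜₀} (h𝒟mul : ∀ a ∈ 𝒟, ∀ b ∈ 𝒟, a * b ∈ 𝒟) (h𝒟act : ∀ n, ∀ a ∈ 𝒟, Z₀.act n a ∈ 𝒟)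
    (hmix : ∀ d ∈ 𝒟, Tendsto (fun n => Z₀.integral (d * Z₀.act n d)) cofinite
      (𝓝 (Z₀.integral d ^ 2)))
    {C : Set 𝒜} (hCmul : ∀ a ∈ C, ∀ b ∈ C, a * b ∈ C) (hCact : ∀ n, ∀ a ∈ C, Z.act n a ∈ C)
    (hind : ∀ c ∈ C, ∀ d ∈ 𝒟, Z.integral (c * φ d) = Z.integral c * Z₀.integral d)
    {c : 𝒜} (hc : c ∈ C) {d : 𝒜₀} (hd : d ∈ 𝒟) (h : 𝒜) :
    Tendsto (fun n => Z.integral (h * Z.act n (c * (φ d - algebraMap ℝ 𝒜 (Z₀.integral d)))))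
      cofinite (𝓝 0) := by
  set δ := Z₀.integral d
  set u : 𝒜 := c * (φ d - algebraMap ℝ 𝒜 δ) with hu
  -- The correlations of `u` are those of `c` multiplied by those of `d`, which tend to zero.
  have hcorr : ∀ n, Z.integral (u * Z.act n u)
      = Z.integral (c * Z.act n c) * (Z₀.integral (d * Z₀.act n d) - δ ^ 2) := by
    intro n
    have hcc := hCmul c hc _ (hCact n c hc)
    have e : u * Z.act n u = (c * Z.act n c) * φ (d * Z₀.act n d)
        - δ • ((c * Z.act n c) * φ d) - δ • ((c * Z.act n c) * φ (Z₀.act n d))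
        + (δ * δ) • (c * Z.act n c) := by
      simp only [hu, map_mul, map_sub, hact, AlgHom.commutes, Algebra.smul_def]
      ring
    rw [e]
    simp only [map_add, map_sub, map_smul, smul_eq_mul]
    rw [hind _ hcc _ (h𝒟mul d hd _ (h𝒟act n d hd)), hind _ hcc _ hd,
      hind _ hcc _ (h𝒟act n d hd), Z₀.integral_act]
    ring
  have hzero : Tendsto (fun n => Z.integral (u * Z.act n u)) cofinite (𝓝 0) := by
    simp only [hcorr]
    refine bdd_le_mul_tendsto_zero' √(Z.integral (c * c) * Z.integral (c * c))
      (Eventually.of_forall fun n => Z.abs_integral_mul_act_le n c c) ?_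
    have := (hmix d hd).sub_const (δ ^ 2)
    rwa [sub_self] at this
  rw [tendsto_iff_ultrafilter]
  intro p hp
  have := Z.tendsto_zero_of_correlations p (fun n => Z.act n u) (Z.integral (u * u))
    (fun i => by rw [← map_mul, Z.integral_act]) (fun i => by
      have e : ∀ j, Z.integral (Z.act j u * Z.act i u) = Z.integral (u * Z.act (j - i) u) := by
        intro j; rw [mul_comm, Z.integral_act_mul_act]
      simp only [e]
      exact hzero.comp ((sub_left_injective (b := i)).tendsto_cofinite.mono_left hp)) h
  exact this.congr fun n => by rw [mul_comm]

/-- A product of recurrent elements is uncorrelated with a mixing family `𝒟`, and even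
conditionally so given a family `C` independent of `𝒟`. Allowing `C` and passing to extensions `𝒜`
of the given system `𝒜₀` is what makes the induction on the number of factors work. -/
theorem AlgSystem.integral_prod_recurrent_eq_zero {𝒜₀ : Type*} [CommRing 𝒜₀] [Algebra ℝ 𝒜₀]
    (Z₀ : AlgSystem 𝒜₀) {𝒟 : Set 𝒜₀} (h𝒟mul : ∀ a ∈ 𝒟, ∀ b ∈ 𝒟, a * b ∈ 𝒟)
    (h𝒟act : ∀ n, ∀ a ∈ 𝒟, Z₀.act n a ∈ 𝒟)
    (hmix : ∀ d ∈ 𝒟, Tendsto (fun n => Z₀.integral (d * Z₀.act n d)) cofinite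
      (𝓝 (Z₀.integral d ^ 2)))
    (L : List 𝒜₀) (hL : ∀ f ∈ L, Z₀.IsRecurrent f) :
    ∀ {𝒜 : Type w} [CommRing 𝒜] [Algebra ℝ 𝒜] (Z : AlgSystem 𝒜) (φ : 𝒜₀ →ₐ[ℝ] 𝒜)
      (_ : ∀ n a, φ (Z₀.act n a) = Z.act n (φ a))
      (_ : ∀ a, Z.integral (φ a) = Z₀.integral a)
      (C : Set 𝒜) (_ : ∀ a ∈ C, ∀ b ∈ C, a * b ∈ C) (_ : ∀ n, ∀ a ∈ C, Z.act n a ∈ C)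
      (_ : ∀ c ∈ C, ∀ d ∈ 𝒟, Z.integral (c * φ d) = Z.integral c * Z₀.integral d),
      ∀ c ∈ C, ∀ d ∈ 𝒟,
        Z.integral (φ L.prod * (c * (φ d - algebraMap ℝ 𝒜 (Z₀.integral d)))) = 0 := by
  induction L with
  | nil =>
    intro 𝒜 _ _ Z φ hact hint C hCmul hCact hind c hc d hd
    have e : φ ([] : List 𝒜₀).prod * (c * (φ d - algebraMap ℝ 𝒜 (Z₀.integral d)))
        = c * φ d - Z₀.integral d • c := by
      simp only [List.prod_nil, map_one, Algebra.smul_def]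
      ring
    rw [e, map_sub, map_smul, hind c hc d hd, smul_eq_mul]
    ring
  | cons f L ih =>
    intro 𝒜 _ _ Z φ hact hint C hCmul hCact hind c hc d hd
    rw [List.prod_cons, map_mul φ, mul_assoc]
    refine AlgSystem.integral_mul_eq_zero_of_isRecurrent hact hint (hL f (by simp)) ?_
    intro h
    rw [tendsto_iff_ultrafilter]
    intro p hp
    obtain ⟨Z', hact', hint'⟩ := Z.exists_graphLimit p
    -- In the limit system, the first coordinate together with `C` in the second coordinate is
    -- again independent of the mixing family in the second coordinate.
    set C' : Set (𝒜 ⊗[ℝ] 𝒜) := {x | ∃ a, ∃ c ∈ C, x = a ⊗ₜ[ℝ] c}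
    have key := ih (fun f hf => hL f (by simp [hf])) Z'
      ((Algebra.TensorProduct.includeRight : 𝒜 →ₐ[ℝ] 𝒜 ⊗[ℝ] 𝒜).comp φ)
      (fun n a => by simp [hact', hact]) (fun a => by
        refine tendsto_nhds_unique (hint' 1 (φ a)) ?_
        simp only [one_mul, Z.integral_act, hint]
        exact tendsto_const_nhds) C'
      (by
        rintro _ ⟨a, c, hc, rfl⟩ _ ⟨a', c', hc', rfl⟩
        exact ⟨a * a', c * c', hCmul c hc c' hc', by simp⟩)
      (by
        rintro n _ ⟨a, c, hc, rfl⟩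
        exact ⟨_, _, hCact n c hc, hact' n a c⟩)
      (by
        rintro _ ⟨a, c, hc, rfl⟩ d hd
        have h0 := (AlgSystem.tendsto_integral_mul_act_centered hact h𝒟mul h𝒟act hmix hCmul hCact
          hind hc hd a).mono_left hp
        have h1 := h0.add ((hint' a c).mul_const (Z₀.integral d))
        rw [zero_add] at h1
        refine tendsto_nhds_unique ?_ h1
        have h2 := hint' a (c * φ d)
        have e : (a ⊗ₜ[ℝ] c) * ((Algebra.TensorProduct.includeRight : 𝒜 →ₐ[ℝ] 𝒜 ⊗[ℝ] 𝒜).comp φ) d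
            = a ⊗ₜ[ℝ] (c * φ d) := by simp
        rw [e]
        refine h2.congr fun n => ?_
        have e2 : a * Z.act n (c * φ d)
            = a * Z.act n (c * (φ d - algebraMap ℝ 𝒜 (Z₀.integral d)))
              + Z₀.integral d • (a * Z.act n c) := by
          simp only [map_mul, map_sub, AlgHom.commutes, Algebra.smul_def]
          ring
        rw [e2, map_add, map_smul, smul_eq_mul, mul_comm (Z₀.integral d)])
      (h ⊗ₜ c) ⟨h, c, hc, rfl⟩ d hd
    have e : ((Algebra.TensorProduct.includeRight : 𝒜 →ₐ[ℝ] 𝒜 ⊗[ℝ] 𝒜).comp φ) L.prod *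
        (h ⊗ₜ[ℝ] c * (((Algebra.TensorProduct.includeRight : 𝒜 →ₐ[ℝ] 𝒜 ⊗[ℝ] 𝒜).comp φ) d -
          algebraMap ℝ (𝒜 ⊗[ℝ] 𝒜) (Z₀.integral d)))
        = h ⊗ₜ[ℝ] (φ L.prod * (c * (φ d - algebraMap ℝ 𝒜 (Z₀.integral d)))) := by
      have : algebraMap ℝ (𝒜 ⊗[ℝ] 𝒜) (Z₀.integral d)
          = 1 ⊗ₜ[ℝ] algebraMap ℝ 𝒜 (Z₀.integral d) :=
        (Algebra.TensorProduct.includeRight.commutes (Z₀.integral d)).symm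
      rw [this]
      simp [← TensorProduct.tmul_sub]
    rw [e] at key
    rw [← key]
    exact hint' _ _

/-! ### Measures determined by moments -/

/-- Finite measures supported in a compact interval are determined by their moments. -/
theorem measure_eq_of_moments_eq {α β : Measure ℝ} [IsFiniteMeasure α] [IsFiniteMeasure β] {M : ℝ}
    (hα : ∀ᵐ x ∂α, x ∈ Set.Icc (-M) M) (hβ : ∀ᵐ x ∂β, x ∈ Set.Icc (-M) M)
    (h : ∀ n : ℕ, ∫ x, x ^ n ∂α = ∫ x, x ^ n ∂β) : α = β := by
  have hint : ∀ (γ : Measure ℝ) [IsFiniteMeasure γ], (∀ᵐ x ∂γ, x ∈ Set.Icc (-M) M) →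
      ∀ n : ℕ, Integrable (fun x : ℝ => x ^ n) γ := by
    intro γ _ hγ n
    refine Integrable.of_bound (by fun_prop) (|M| ^ n) ?_
    filter_upwards [hγ] with x hx
    rw [norm_pow, Real.norm_eq_abs]
    exact pow_le_pow_left₀ (abs_nonneg _) (abs_le_abs (by linarith [hx.2]) (by linarith [hx.1])) n
  have hpint : ∀ (γ : Measure ℝ) [IsFiniteMeasure γ], (∀ᵐ x ∂γ, x ∈ Set.Icc (-M) M) →
      ∀ p : Polynomial ℝ, Integrable (fun x : ℝ => p.eval x) γ := by
    intro γ _ hγ p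
    simp only [Polynomial.eval_eq_sum_range]
    exact integrable_finsetSum _ fun i _ => (hint γ hγ i).const_mul _
  have hp : ∀ p : Polynomial ℝ, ∫ x, p.eval x ∂α = ∫ x, p.eval x ∂β := by
    intro p
    simp only [Polynomial.eval_eq_sum_range]
    rw [integral_finsetSum _ fun i _ => (hint α hα i).const_mul _,
      integral_finsetSum _ fun i _ => (hint β hβ i).const_mul _]
    simp only [integral_const_mul, h]
  refine ext_of_forall_integral_eq_of_IsFiniteMeasure fun f => ?_
  have happrox : ∀ (γ : Measure ℝ) [IsFiniteMeasure γ], (∀ᵐ x ∂γ, x ∈ Set.Icc (-M) M) →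
      ∀ (p : Polynomial ℝ) (ε : ℝ), (∀ x ∈ Set.Icc (-M) M, |p.eval x - f x| < ε) →
      |∫ x, p.eval x ∂γ - ∫ x, f x ∂γ| ≤ ε * γ.real Set.univ := by
    intro γ _ hγ p ε hpε
    rw [← integral_sub (hpint γ hγ p) (f.integrable γ), ← Real.norm_eq_abs]
    refine norm_integral_le_of_norm_le_const ?_
    filter_upwards [hγ] with x hx
    exact (hpε x hx).le
  refine eq_of_abs_sub_nonpos (le_of_forall_pos_le_add fun δ hδ => ?_)
  set c := α.real Set.univ + β.real Set.univ + 1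
  have hc : 0 < c := by positivity
  obtain ⟨p, hpε⟩ := exists_polynomial_near_of_continuousOn (-M) M f f.continuous.continuousOn
    (δ / c) (by positivity)
  have h1 := happrox α hα p _ hpε
  have h2 := happrox β hβ p _ hpε
  rw [hp p] at h1
  have h3 := abs_sub_le (∫ x, f x ∂α) (∫ x, p.eval x ∂β) (∫ x, f x ∂β)
  rw [abs_sub_comm (∫ x, f x ∂α) (∫ x, p.eval x ∂β)] at h3
  have h4 : δ / c * α.real Set.univ + δ / c * β.real Set.univ ≤ δ := by
    rw [← mul_add, div_mul_eq_mul_div, div_le_iff₀ hc]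
    nlinarith
  linarith

variable {X : Type*} [MeasurableSpace X]

theorem measurable_and_bounded_list_prod {R : Set (X → ℝ)}
    (hR : ∀ f ∈ R, Measurable f ∧ ∃ C, ∀ x, |f x| ≤ C) (L : List (X → ℝ)) (hL : ∀ f ∈ L, f ∈ R) :
    Measurable L.prod ∧ ∃ C, ∀ x, |L.prod x| ≤ C := by
  induction L with
  | nil => exact ⟨measurable_one, 1, by simp⟩
  | cons f L ih =>
    obtain ⟨hm, C, hC⟩ := ih fun g hg => hL g (by simp [hg])
    obtain ⟨hfm, D, hD⟩ := hR f (hL f (by simp))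
    rw [List.prod_cons]
    refine ⟨hfm.mul hm, D * C, fun x => ?_⟩
    rw [Pi.mul_apply, abs_mul]
    exact mul_le_mul (hD x) (hC x) (abs_nonneg _) ((abs_nonneg _).trans (hD x))

/-- If two finite measures have the same mixed moments with respect to a family of bounded
functions, so do their restrictions to a set defined by one function of the family. -/
theorem setIntegral_list_prod_eq {ξ₁ ξ₂ : Measure X} [IsFiniteMeasure ξ₁] [IsFiniteMeasure ξ₂]
    {R : Set (X → ℝ)} (hR : ∀ f ∈ R, Measurable f ∧ ∃ C, ∀ x, |f x| ≤ C)
    (h : ∀ L : List (X → ℝ), (∀ f ∈ L, f ∈ R) → ∫ x, L.prod x ∂ξ₁ = ∫ x, L.prod x ∂ξ₂)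
    {f : X → ℝ} (hf : f ∈ R) {s : Set ℝ} (hs : MeasurableSet s) (L : List (X → ℝ))
    (hL : ∀ f ∈ L, f ∈ R) :
    ∫ x, L.prod x ∂(ξ₁.restrict (f ⁻¹' s)) = ∫ x, L.prod x ∂(ξ₂.restrict (f ⁻¹' s)) := by
  obtain ⟨hfm, M, hM⟩ := hR f hf
  have hfs : MeasurableSet (f ⁻¹' s) := hfm hs
  have hint : ∀ (ξ : Measure X) [IsFiniteMeasure ξ] (L : List (X → ℝ)), (∀ f ∈ L, f ∈ R) →
      Integrable L.prod ξ := by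
    intro ξ _ L hL
    obtain ⟨hm, C, hC⟩ := measurable_and_bounded_list_prod hR L hL
    exact Integrable.of_bound hm.aestronglyMeasurable C (Eventually.of_forall hC)
  -- The claim for a nonnegative weight `L.prod + C` follows from the one-dimensional moment
  -- problem for the law of `f` with this weight.
  have key : ∀ (L : List (X → ℝ)), (∀ f ∈ L, f ∈ R) → ∀ C : ℝ, (∀ x, |L.prod x| ≤ C) →
      ∫ x, L.prod x ∂(ξ₁.restrict (f ⁻¹' s)) + C * ξ₁.real (f ⁻¹' s)
        = ∫ x, L.prod x ∂(ξ₂.restrict (f ⁻¹' s)) + C * ξ₂.real (f ⁻¹' s) := by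
    intro L hL C hC
    obtain ⟨hLm, -⟩ := measurable_and_bounded_list_prod hR L hL
    have hq0 : ∀ x, 0 ≤ L.prod x + C := fun x => by linarith [(abs_le.1 (hC x)).1]
    have hqm : Measurable fun x => ENNReal.ofReal (L.prod x + C) :=
      (hLm.add_const C).ennreal_ofReal
    have hqint : ∀ (ξ : Measure X) [IsFiniteMeasure ξ], Integrable (fun x => L.prod x + C) ξ :=
      fun ξ _ => (hint ξ L hL).add (integrable_const C)
    have hfin : ∀ (ξ : Measure X) [IsFiniteMeasure ξ],
        IsFiniteMeasure (ξ.withDensity fun x => ENNReal.ofReal (L.prod x + C)) :=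
      fun ξ _ => isFiniteMeasure_withDensity_ofReal (hqint ξ).2
    have hmom : ∀ (ξ : Measure X) [IsFiniteMeasure ξ] (n : ℕ),
        ∫ x, x ^ n ∂((ξ.withDensity fun x => ENNReal.ofReal (L.prod x + C)).map f)
          = ∫ x, (List.replicate n f ++ L).prod x ∂ξ + C * ∫ x, (List.replicate n f).prod x ∂ξ := by
      intro ξ _ n
      have hr : ∀ g ∈ List.replicate n f, g ∈ R := fun g hg => by
        rw [(List.mem_replicate.1 hg).2]; exact hf
      rw [integral_map hfm.aemeasurable (by fun_prop),
        integral_withDensity_eq_integral_toReal_smul hqm (by simp), ← integral_const_mul,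
        ← integral_add (hint ξ _ fun g hg => (List.mem_append.1 hg).elim (hr g) (hL g))
          ((hint ξ _ hr).const_mul C)]
      congr 1
      ext x
      rw [ENNReal.toReal_ofReal (hq0 x), List.prod_append, List.prod_replicate]
      simp only [Pi.mul_apply, Pi.pow_apply, smul_eq_mul]
      ring
    have hae : ∀ (ξ : Measure X) [IsFiniteMeasure ξ], ∀ᵐ x ∂(ξ.map f), x ∈ Set.Icc (-M) M := by
      intro ξ _
      refine (ae_map_iff hfm.aemeasurable (p := fun x => x ∈ Set.Icc (-M) M)
        measurableSet_Icc).2 ?_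
      exact Eventually.of_forall fun x => abs_le.1 (hM x)
    have := hfin ξ₁
    have := hfin ξ₂
    have heq := measure_eq_of_moments_eq
      (hae (ξ₁.withDensity fun x => ENNReal.ofReal (L.prod x + C)))
      (hae (ξ₂.withDensity fun x => ENNReal.ofReal (L.prod x + C))) (fun n => by
      rw [hmom ξ₁ n, hmom ξ₂ n]
      have hr : ∀ g ∈ List.replicate n f, g ∈ R := fun g hg => by
        rw [(List.mem_replicate.1 hg).2]; exact hf
      rw [h _ hr, h _ fun g hg => (List.mem_append.1 hg).elim (hr g) (hL g)])
    have hval : ∀ (ξ : Measure X) [IsFiniteMeasure ξ],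
        (((ξ.withDensity fun x => ENNReal.ofReal (L.prod x + C)).map f) s).toReal
          = ∫ x, L.prod x ∂(ξ.restrict (f ⁻¹' s)) + C * ξ.real (f ⁻¹' s) := by
      intro ξ _
      rw [Measure.map_apply hfm hs, withDensity_apply _ hfs,
        ← ofReal_integral_eq_lintegral_ofReal (hqint _) (Eventually.of_forall hq0),
        ENNReal.toReal_ofReal (integral_nonneg hq0),
        integral_add (hint _ L hL) (integrable_const C), integral_const]
      simp [mul_comm]
    rw [← hval ξ₁, ← hval ξ₂, heq]
  obtain ⟨-, C, hC⟩ := measurable_and_bounded_list_prod hR L hL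
  have h1 := key L hL C hC
  have h2 := key [] (by simp) 1 (by simp)
  simp only [List.prod_nil, Pi.one_apply, integral_const, smul_eq_mul, mul_one, one_mul,
    measureReal_restrict_apply_univ] at h2
  have h3 : ξ₁.real (f ⁻¹' s) = ξ₂.real (f ⁻¹' s) := by linarith
  rw [h3] at h1
  linarith

/-- The `σ`-algebra generated by a family of real functions. -/
@[reducible]
def functionSigmaAlgebra {X : Type*} (R : Set (X → ℝ)) : MeasurableSpace X :=
  MeasurableSpace.generateFrom {B | ∃ f ∈ R, ∃ s : Set ℝ, MeasurableSet s ∧ B = f ⁻¹' s}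

/-- Two finite measures with the same mixed moments with respect to a family of bounded functions
agree on the `σ`-algebra generated by the family. -/
theorem measure_eq_of_mixed_moments_eq {ξ₁ ξ₂ : Measure X} [IsFiniteMeasure ξ₁]
    [IsFiniteMeasure ξ₂] {R : Set (X → ℝ)} (hR : ∀ f ∈ R, Measurable f ∧ ∃ C, ∀ x, |f x| ≤ C)
    (h : ∀ L : List (X → ℝ), (∀ f ∈ L, f ∈ R) → ∫ x, L.prod x ∂ξ₁ = ∫ x, L.prod x ∂ξ₂)
    {A : Set X}
    (hA : MeasurableSet[functionSigmaAlgebra R] A) : ξ₁ A = ξ₂ A := by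
  set 𝒢 : Set (Set X) := {B | ∃ f ∈ R, ∃ s : Set ℝ, MeasurableSet s ∧ B = f ⁻¹' s}
  have hle : MeasurableSpace.generateFrom 𝒢 ≤ ‹MeasurableSpace X› := by
    refine MeasurableSpace.generateFrom_le ?_
    rintro _ ⟨f, hf, s, hs, rfl⟩
    exact (hR f hf).1 hs
  have hfinal : ∀ (ξ₁ ξ₂ : Measure X) [IsFiniteMeasure ξ₁] [IsFiniteMeasure ξ₂],
      (∀ L : List (X → ℝ), (∀ f ∈ L, f ∈ R) → ∫ x, L.prod x ∂ξ₁ = ∫ x, L.prod x ∂ξ₂) →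
      ξ₁ Set.univ = ξ₂ Set.univ := by
    intro ξ₁ ξ₂ _ _ h
    have := h [] (by simp)
    simp only [List.prod_nil, Pi.one_apply, integral_const, smul_eq_mul, mul_one] at this
    exact (ENNReal.toReal_eq_toReal_iff' (measure_ne_top _ _) (measure_ne_top _ _)).1 this
  -- Restricting to the sets `f ⁻¹' s` one after the other reaches all finite intersections.
  have hpi : ∀ B ∈ generatePiSystem 𝒢, MeasurableSet B ∧
      ∀ (ξ₁ ξ₂ : Measure X) [IsFiniteMeasure ξ₁] [IsFiniteMeasure ξ₂],
      (∀ L : List (X → ℝ), (∀ f ∈ L, f ∈ R) → ∫ x, L.prod x ∂ξ₁ = ∫ x, L.prod x ∂ξ₂) →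
      ∀ L : List (X → ℝ), (∀ f ∈ L, f ∈ R) →
        ∫ x, L.prod x ∂(ξ₁.restrict B) = ∫ x, L.prod x ∂(ξ₂.restrict B) := by
    intro B hB
    induction hB with
    | base hs =>
      obtain ⟨f, hf, s, hs, rfl⟩ := hs
      exact ⟨(hR f hf).1 hs, fun ξ₁ ξ₂ _ _ h L hL => setIntegral_list_prod_eq hR h hf hs L hL⟩
    | inter _ _ _ ihs iht =>
      refine ⟨ihs.1.inter iht.1, fun ξ₁ ξ₂ _ _ h L hL => ?_⟩
      have := ihs.2 _ _ (iht.2 ξ₁ ξ₂ h) L hL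
      rwa [Measure.restrict_restrict ihs.1, Measure.restrict_restrict ihs.1] at this
  have heq : ξ₁.trim hle = ξ₂.trim hle := by
    refine @ext_of_generate_finite X (MeasurableSpace.generateFrom 𝒢) _ _ (generatePiSystem 𝒢)
      generateFrom_generatePiSystem_eq.symm (isPiSystem_generatePiSystem 𝒢) _ ?_ ?_
    · intro B hB
      have hBm : MeasurableSet[MeasurableSpace.generateFrom 𝒢] B := by
        rw [← generateFrom_generatePiSystem_eq]
        exact MeasurableSpace.measurableSet_generateFrom hB
      rw [trim_measurableSet_eq hle hBm, trim_measurableSet_eq hle hBm]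
      simpa using hfinal _ _ ((hpi B hB).2 ξ₁ ξ₂ h)
    · rw [trim_measurableSet_eq hle .univ, trim_measurableSet_eq hle .univ]
      exact hfinal ξ₁ ξ₂ h
  rw [← trim_measurableSet_eq hle hA, heq, trim_measurableSet_eq hle hA]

/-! ### Systems of bounded measurable functions -/

section Zpow

variable {X Y : Type*} [MeasurableSpace X] [MeasurableSpace Y]

theorem zpow_zero_apply (T : X ≃ᵐ X) (x : X) : zpow T 0 x = x := by simp [zpow]

theorem zpow_one_apply (T : X ≃ᵐ X) (x : X) : zpow T 1 x = T x := by simp [zpow]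

theorem zpow_add_apply (T : X ≃ᵐ X) (m n : ℤ) (x : X) :
    zpow T (m + n) x = zpow T m (zpow T n x) := by
  simp [zpow, zpow_add]

theorem zpow_natCast (T : X ≃ᵐ X) (n : ℕ) : zpow T n = T^[n] := by
  ext x
  simp only [zpow, _root_.zpow_natCast, Equiv.Perm.coe_pow]
  rfl

theorem measurePreserving_zpow {μ : Measure X} {T : X ≃ᵐ X} (hT : MeasurePreserving T μ μ)
    (n : ℤ) : MeasurePreserving (zpow T n) μ μ := by
  have hneg : MeasurePreserving (zpow T (-1)) μ μ := by
    have : zpow T (-1) = T.symm := by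
      ext x
      simp only [zpow, zpow_neg, zpow_one]
      rfl
    rw [this]
    exact hT.symm
  induction n using Int.induction_on with
  | zero =>
    have : zpow T 0 = id := funext (zpow_zero_apply T)
    rw [this]
    exact MeasurePreserving.id μ
  | succ n ih =>
    have : zpow T (n + 1) = zpow T n ∘ T := funext fun x => by
      rw [zpow_add_apply, zpow_one_apply]; rfl
    rw [this]
    exact ih.comp hT
  | pred n ih =>
    have : zpow T (-n - 1) = zpow T (-n) ∘ zpow T (-1) := funext fun x => by
      rw [sub_eq_add_neg, zpow_add_apply]; rfl
    rw [this]
    exact ih.comp hneg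

theorem integral_comp_zpow {μ : Measure X} {T : X ≃ᵐ X} (hT : MeasurePreserving T μ μ) (n : ℤ)
    {g : X → ℝ} (hg : Measurable g) : ∫ x, g (zpow T n x) ∂μ = ∫ x, g x ∂μ := by
  have h := measurePreserving_zpow hT n
  rw [← integral_map h.measurable.aemeasurable hg.aestronglyMeasurable, h.map_eq]

theorem zpow_prodCongr (T : X ≃ᵐ X) (S : Y ≃ᵐ Y) (n : ℤ) (p : X × Y) :
    zpow (T.prodCongr S) n p = (zpow T n p.1, zpow S n p.2) := by
  have hneg : ∀ p : X × Y, zpow (T.prodCongr S) (-1) p = (zpow T (-1) p.1, zpow S (-1) p.2) := by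
    intro p
    simp only [zpow, zpow_neg, zpow_one]
    rfl
  induction n using Int.induction_on generalizing p with
  | zero => simp [zpow_zero_apply]
  | succ n ih =>
    rw [zpow_add_apply, zpow_add_apply, zpow_add_apply, ih]
    simp only [zpow_one_apply]
    rfl
  | pred n ih =>
    rw [sub_eq_add_neg, zpow_add_apply, zpow_add_apply, zpow_add_apply, ih, hneg]

end Zpow

/-- The algebra of bounded measurable real functions. -/
def boundedMeasurable (X : Type*) [MeasurableSpace X] : Subalgebra ℝ (X → ℝ) where
  carrier := {f | Measurable f ∧ ∃ C, ∀ x, |f x| ≤ C}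
  mul_mem' := by
    rintro f g ⟨hf, C, hC⟩ ⟨hg, D, hD⟩
    refine ⟨hf.mul hg, C * D, fun x => ?_⟩
    rw [Pi.mul_apply, abs_mul]
    exact mul_le_mul (hC x) (hD x) (abs_nonneg _) ((abs_nonneg _).trans (hC x))
  add_mem' := by
    rintro f g ⟨hf, C, hC⟩ ⟨hg, D, hD⟩
    exact ⟨hf.add hg, C + D, fun x => (abs_add_le _ _).trans (add_le_add (hC x) (hD x))⟩
  algebraMap_mem' := fun r => ⟨measurable_const, |r|, fun _ => le_rfl⟩

section Systems

variable {X Y : Type*} [MeasurableSpace X] [MeasurableSpace Y]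

theorem boundedMeasurable.measurable (f : boundedMeasurable X) : Measurable (f : X → ℝ) := f.2.1

theorem boundedMeasurable.integrable (f : boundedMeasurable X) (μ : Measure X)
    [IsFiniteMeasure μ] : Integrable (f : X → ℝ) μ := by
  obtain ⟨hf, C, hC⟩ := f.2
  exact Integrable.of_bound hf.aestronglyMeasurable C (Eventually.of_forall hC)

theorem boundedMeasurable.memLp (f : boundedMeasurable X) (μ : Measure X)
    [IsFiniteMeasure μ] (p : ENNReal) : MemLp (f : X → ℝ) p μ := by
  obtain ⟨hf, C, hC⟩ := f.2
  exact MemLp.of_bound hf.aestronglyMeasurable C (Eventually.of_forall hC)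

/-- Composition with a measurable map. -/
def boundedMeasurable.comp (g : X → Y) (hg : Measurable g) :
    boundedMeasurable Y →ₐ[ℝ] boundedMeasurable X where
  toFun f := ⟨fun x => (f : Y → ℝ) (g x), f.2.1.comp hg, f.2.2.imp fun _ h x => h (g x)⟩
  map_one' := rfl
  map_mul' _ _ := rfl
  map_zero' := rfl
  map_add' _ _ := rfl
  commutes' _ := rfl

@[simp]
theorem boundedMeasurable.comp_apply (g : X → Y) (hg : Measurable g) (f : boundedMeasurable Y)
    (x : X) : (boundedMeasurable.comp g hg f : X → ℝ) x = (f : Y → ℝ) (g x) := rfl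

/-- The algebraic system of bounded measurable functions of an automorphism. -/
noncomputable def functionSystem (μ : Measure X) [IsFiniteMeasure μ] (T : X ≃ᵐ X)
    (hT : MeasurePreserving T μ μ) : AlgSystem (boundedMeasurable X) where
  act n := boundedMeasurable.comp (zpow T n) (measurable_zpow T n)
  integral :=
    { toFun := fun f => ∫ x, (f : X → ℝ) x ∂μ
      map_add' := fun f g => 
        integral_add (boundedMeasurable.integrable f μ) (boundedMeasurable.integrable g μ)
      map_smul' := fun r f => integral_const_mul r _ }
  act_zero f := by
    ext x
    simp [zpow_zero_apply]
  act_add m n f := by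
    ext x
    simp only [boundedMeasurable.comp_apply]
    rw [add_comm, zpow_add_apply]
  integral_act n f := integral_comp_zpow hT n (boundedMeasurable.measurable f)
  integral_sq_nonneg f := integral_nonneg fun x => mul_self_nonneg _

theorem functionSystem_act (μ : Measure X) [IsFiniteMeasure μ] (T : X ≃ᵐ X)
    (hT : MeasurePreserving T μ μ) (n : ℤ) (f : boundedMeasurable X) (x : X) :
    ((functionSystem μ T hT).act n f : X → ℝ) x = (f : X → ℝ) (zpow T n x) := rfl

theorem AlgSystem.IsRecurrent.map {𝒜 ℬ : Type*} [CommRing 𝒜] [Algebra ℝ 𝒜] [CommRing ℬ]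
    [Algebra ℝ ℬ] {Z : AlgSystem 𝒜} {W : AlgSystem ℬ} {φ : 𝒜 →ₐ[ℝ] ℬ}
    (hact : ∀ n a, φ (Z.act n a) = W.act n (φ a)) (hint : ∀ a, W.integral (φ a) = Z.integral a)
    {f : 𝒜} (hf : Z.IsRecurrent f) : W.IsRecurrent (φ f) := by
  obtain ⟨h, hh⟩ := hf
  refine ⟨φ h, fun K ε hε => ?_⟩
  obtain ⟨w, hw, hfw⟩ := hh K ε hε
  refine ⟨φ w, ?_, by rwa [← map_sub, ← map_mul φ, hint]⟩
  have := Set.mem_image_of_mem φ.toLinearMap hw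
  rw [LinearMap.image_convexHull, Set.image_image] at this
  simpa only [AlgHom.toLinearMap_apply, hact] using this

theorem tendsto_measureReal_inter_zpow {ν : Measure Y} [IsProbabilityMeasure ν] {S : Y ≃ᵐ Y}
    (hS : MeasurePreserving S ν ν) (hmix : IsMixing ν S) {D : Set Y} (hD : MeasurableSet D) :
    Tendsto (fun n : ℤ => ν.real (D ∩ zpow S n ⁻¹' D)) cofinite (𝓝 (ν.real D ^ 2)) := by
  have hneg : ∀ n, ν.real (D ∩ zpow S (-n) ⁻¹' D) = ν.real (D ∩ zpow S n ⁻¹' D) := by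
    intro n
    have hm : MeasurableSet (D ∩ zpow S (-n) ⁻¹' D) := hD.inter (measurable_zpow S _ hD)
    rw [← (measurePreserving_zpow hS n).measureReal_preimage hm.nullMeasurableSet]
    congr 1
    ext y
    simp only [Set.mem_preimage, Set.mem_inter_iff, ← zpow_add_apply, neg_add_cancel,
      zpow_zero_apply]
    exact and_comm
  -- By invariance the correlation depends on `|n|` only, so mixing along `ℕ` is enough.
  have habs : ∀ n : ℤ, ν.real (D ∩ zpow S n ⁻¹' D) = ν.real (D ∩ S^[n.natAbs] ⁻¹' D) := by
    intro n
    rw [← zpow_natCast]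
    rcases Int.natAbs_eq n with h | h
    · rw [← h]
    · rw [← hneg, ← neg_eq_iff_eq_neg.2 h]
  simp only [habs]
  have h := (ENNReal.tendsto_toReal (by finiteness)).comp (hmix D D hD hD)
  rw [ENNReal.toReal_mul, ← sq] at h
  refine h.comp ?_
  rw [Int.cofinite_eq, tendsto_sup]
  constructor <;> refine tendsto_atTop.2 fun b => ?_
  · filter_upwards [eventually_le_atBot (-(b : ℤ))] with n hn
    omega
  · filter_upwards [eventually_ge_atTop (b : ℤ)] with n hn
    omega

theorem IsJoining.isProbabilityMeasure {μ : Measure X} [IsProbabilityMeasure μ] {T : X → X}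
    {ν : Measure Y} {S : Y → Y} {ρ : Measure (X × Y)} (hρ : IsJoining μ T ν S ρ) :
    IsProbabilityMeasure ρ := by
  have h := hρ.fst.measure_preimage MeasurableSet.univ.nullMeasurableSet
  rw [Set.preimage_univ] at h
  exact ⟨h.trans measure_univ⟩

/-- Functions of `X` that are recurrent are, together, independent of every set of a mixing system
in any joining: here in terms of integrals of products. -/
theorem setIntegral_prod_recurrent {μ : Measure X} [IsProbabilityMeasure μ] {T : X ≃ᵐ X}
    (hT : MeasurePreserving T μ μ) {ν : Measure Y} [IsProbabilityMeasure ν] {S : Y ≃ᵐ Y}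
    (hS : MeasurePreserving S ν ν) (hmix : IsMixing ν S) {ρ : Measure (X × Y)}
    (hρ : IsJoining μ T ν S ρ) {D : Set Y} (hD : MeasurableSet D) (L : List (boundedMeasurable X))
    (hL : ∀ f ∈ L, (functionSystem μ T hT).IsRecurrent f) :
    ∫ p in Prod.snd ⁻¹' D, (L.prod : X → ℝ) p.1 ∂ρ = ν.real D * ∫ x, (L.prod : X → ℝ) x ∂μ := by
  have := hρ.isProbabilityMeasure
  have hinv : MeasurePreserving (T.prodCongr S) ρ ρ := hρ.invariant
  set Z := functionSystem ρ (T.prodCongr S) hinv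
  set φ : boundedMeasurable X →ₐ[ℝ] boundedMeasurable (X × Y) :=
    boundedMeasurable.comp Prod.fst measurable_fst
  have hφint : ∀ f : boundedMeasurable X,
      Z.integral (φ f) = (functionSystem μ T hT).integral f := by
    intro f
    change ∫ p, (f : X → ℝ) p.1 ∂ρ = ∫ x, (f : X → ℝ) x ∂μ
    rw [← hρ.fst.map_eq, integral_map hρ.fst.measurable.aemeasurable
      (boundedMeasurable.measurable f).aestronglyMeasurable]
  have hφact : ∀ n (f : boundedMeasurable X),
      φ ((functionSystem μ T hT).act n f) = Z.act n (φ f) := by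
    intro n f
    ext p
    simp only [φ, Z, boundedMeasurable.comp_apply, functionSystem_act, zpow_prodCongr]
  -- The mixing family consists of the indicators of measurable sets of `Y`
  set ind : {D : Set Y // MeasurableSet D} → boundedMeasurable (X × Y) := fun D =>
    ⟨(Prod.snd ⁻¹' D.1).indicator 1, measurable_one.indicator (measurable_snd D.2), 1, fun p => by
      by_cases hp : p ∈ Prod.snd ⁻¹' D.1 <;> simp [hp]⟩
  have hind_int : ∀ D, Z.integral (ind D) = ν.real D.1 := by
    intro D
    change ∫ p, (Prod.snd ⁻¹' D.1).indicator 1 p ∂ρ = _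
    rw [integral_indicator_one (measurable_snd D.2),
      hρ.snd.measureReal_preimage D.2.nullMeasurableSet]
  have hind_mul : ∀ D E, ind D * ind E = ind ⟨D.1 ∩ E.1, D.2.inter E.2⟩ := by
    intro D E
    ext p
    change (Prod.snd ⁻¹' D.1).indicator 1 p * (Prod.snd ⁻¹' E.1).indicator 1 p
      = (Prod.snd ⁻¹' (D.1 ∩ E.1)).indicator (1 : X × Y → ℝ) p
    rw [Set.preimage_inter, Set.inter_indicator_one]
    rfl
  have hind_act : ∀ n D, Z.act n (ind D) = ind ⟨zpow S n ⁻¹' D.1, measurable_zpow S n D.2⟩ := by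
    intro n D
    ext p
    rw [functionSystem_act, zpow_prodCongr]
    rfl
  have key := AlgSystem.integral_prod_recurrent_eq_zero Z (𝒟 := Set.range ind)
    (by
      rintro _ ⟨D, rfl⟩ _ ⟨E, rfl⟩
      exact ⟨_, (hind_mul D E).symm⟩)
    (by
      rintro n _ ⟨D, rfl⟩
      exact ⟨_, (hind_act n D).symm⟩)
    (by
      rintro _ ⟨D, rfl⟩
      simp only [hind_act, hind_mul, hind_int]
      exact tendsto_measureReal_inter_zpow hS hmix D.2)
    (L.map φ) (by
      intro f hf
      obtain ⟨g, hg, rfl⟩ := List.mem_map.1 hf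
      exact (hL g hg).map hφact hφint)
    Z (AlgHom.id ℝ _) (fun _ _ => rfl) (fun _ => rfl) {1} (by simp) (by simp)
    (by
      rintro c rfl d -
      have h1 : Z.integral 1 = 1 := by
        change ∫ _, (1 : ℝ) ∂ρ = 1
        simp
      rw [one_mul, h1, one_mul]
      rfl) 1 rfl (ind ⟨D, hD⟩) ⟨_, rfl⟩
  rw [one_mul, AlgHom.id_apply, AlgHom.id_apply, ← map_list_prod, mul_sub, map_sub, sub_eq_zero,
    hind_int, mul_comm (φ L.prod) (algebraMap _ _ _), ← Algebra.smul_def, map_smul, hφint] at key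
  rw [← integral_indicator (measurable_snd hD)]
  refine Eq.trans ?_ key
  change _ = ∫ p, (φ L.prod * ind ⟨D, hD⟩ : boundedMeasurable (X × Y)).1 p ∂ρ
  congr 1
  ext p
  by_cases hp : p ∈ Prod.snd ⁻¹' D
  · rw [Set.indicator_of_mem hp]
    change _ = (L.prod : X → ℝ) p.1 * (Prod.snd ⁻¹' D).indicator 1 p
    rw [Set.indicator_of_mem hp, Pi.one_apply, mul_one]
  · rw [Set.indicator_of_notMem hp]
    change _ = (L.prod : X → ℝ) p.1 * (Prod.snd ⁻¹' D).indicator 1 p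
    rw [Set.indicator_of_notMem hp, mul_zero]

/-- If the `σ`-algebra of `X` is generated, modulo null sets, by almost everywhere limits of
recurrent functions, then the system is disjoint from every mixing system. -/
theorem eq_prod_of_isJoining_of_isMixing {μ : Measure X} [IsProbabilityMeasure μ] {T : X ≃ᵐ X}
    (hT : MeasurePreserving T μ μ) {𝓖 : Set (Set X)}
    (hgen : ‹MeasurableSpace X› = MeasurableSpace.generateFrom 𝓖)
    (h𝓖 : ∀ B ∈ 𝓖, ∃ (F : X → ℝ) (s : Set ℝ), MeasurableSet s ∧ B =ᵐ[μ] F ⁻¹' s ∧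
      ∃ f : ℕ → boundedMeasurable X, (∀ n, (functionSystem μ T hT).IsRecurrent (f n)) ∧
        ∀ᵐ x ∂μ, Tendsto (fun n => (f n : X → ℝ) x) atTop (𝓝 (F x)))
    {ν : Measure Y} [IsProbabilityMeasure ν] {S : Y ≃ᵐ Y} (hS : MeasurePreserving S ν ν)
    (hmix : IsMixing ν S) {ρ : Measure (X × Y)} (hρ : IsJoining μ T ν S ρ) :
    ρ = μ.prod ν := by
  have := hρ.isProbabilityMeasure
  set R : Set (X → ℝ) := Subtype.val '' {f | (functionSystem μ T hT).IsRecurrent f}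
  have hR : ∀ f ∈ R, Measurable f ∧ ∃ C, ∀ x, |f x| ≤ C := by
    rintro _ ⟨f, -, rfl⟩
    exact f.2
  have hlift : ∀ L : List (X → ℝ), (∀ f ∈ L, f ∈ R) → ∃ L' : List (boundedMeasurable X),
      (∀ f ∈ L', (functionSystem μ T hT).IsRecurrent f) ∧ (L'.prod : X → ℝ) = L.prod := by
    intro L
    induction L with
    | nil => exact fun _ => ⟨[], by simp⟩
    | cons f L ih =>
      intro h
      obtain ⟨L', h1, h2⟩ := ih fun g hg => h g (by simp [hg])
      obtain ⟨f', hf', rfl⟩ := h f (by simp)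
      refine ⟨f' :: L', ?_, by simp [h2]⟩
      intro g hg
      rcases List.mem_cons.1 hg with rfl | hg
      exacts [hf', h1 g hg]
  have hRσ : ∀ f ∈ R, Measurable[functionSigmaAlgebra R] f := fun f hf s hs =>
    MeasurableSpace.measurableSet_generateFrom ⟨f, hf, s, hs, rfl⟩
  have hall : ‹MeasurableSpace X› ≤ eventuallyMeasurableSpace (functionSigmaAlgebra R) (ae μ) := by
    conv_lhs => rw [hgen]
    refine MeasurableSpace.generateFrom_le fun B hB => ?_
    obtain ⟨F, s, hs, hBF, f, hf, hlim⟩ := h𝓖 B hB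
    -- The `limsup` is a version of `F` that is measurable with respect to the functions `f n`.
    refine ⟨(fun x => limsup (fun n => (f n : X → ℝ) x) atTop) ⁻¹' s,
      Measurable.limsup (fun n => hRσ _ ⟨f n, hf n, rfl⟩) hs, hBF.trans ?_⟩
    have : F =ᵐ[μ] fun x => limsup (fun n => (f n : X → ℝ) x) atTop := by
      filter_upwards [hlim] with x hx
      exact hx.limsup_eq.symm
    filter_upwards [this] with x hx
    simp only [Set.preimage, eq_iff_iff]
    change F x ∈ s ↔ _ ∈ s
    rw [hx]
  refine (Measure.prod_eq fun A D hA hD => ?_).symm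
  -- For fixed `D`, compare `A ↦ ρ (A ×ˢ D)` with `A ↦ μ A * ν D`.
  set ξ₁ : Measure X := (ρ.restrict (Prod.snd ⁻¹' D)).map Prod.fst
  set ξ₂ : Measure X := ν D • μ
  have hξ₁ : ∀ A, MeasurableSet A → ξ₁ A = ρ (A ×ˢ D) := by
    intro A hA
    rw [Measure.map_apply measurable_fst hA, Measure.restrict_apply (measurable_fst hA),
      Set.prod_eq]
  have : IsFiniteMeasure ξ₂ := by
    refine ⟨?_⟩
    simp only [ξ₂, Measure.smul_apply, smul_eq_mul]
    finiteness
  obtain ⟨A', hA', hAA'⟩ := hall A hA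
  have hae₁ : A =ᵐ[ξ₁] A' := by
    have hac : ξ₁ ≪ μ := by
      rw [← hρ.fst.map_eq]
      exact (Measure.restrict_le_self.absolutelyContinuous).map measurable_fst
    exact hac.ae_le hAA'
  have hae₂ : A =ᵐ[ξ₂] A' := (Measure.smul_absolutelyContinuous (c := ν D)).ae_le hAA'
  have heq : ξ₁ A' = ξ₂ A' := by
    refine measure_eq_of_mixed_moments_eq hR (fun L hL => ?_) hA'
    obtain ⟨L', hL', hprod⟩ := hlift L hL
    rw [← hprod, integral_map measurable_fst.aemeasurable
      (boundedMeasurable.measurable L'.prod).aestronglyMeasurable,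
      setIntegral_prod_recurrent hT hS hmix hρ hD L' hL', integral_smul_measure]
    rfl
  rw [← hξ₁ A hA, measure_congr hae₁, heq, ← measure_congr hae₂]
  simp [ξ₂, mul_comm]

end Systems

/-! ### Weak limits of translates are recurrent -/

section WeakLimits

variable {X : Type*} [MeasurableSpace X]

/-- The class in `L²` of a bounded measurable function. -/
noncomputable def boundedMeasurable.toLp (μ : Measure X) [IsFiniteMeasure μ] :
    boundedMeasurable X →ₗ[ℝ] Lp ℝ 2 μ where
  toFun f := MemLp.toLp (f : X → ℝ) (boundedMeasurable.memLp f μ 2)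
  map_add' f g := MemLp.toLp_add (boundedMeasurable.memLp f μ 2) (boundedMeasurable.memLp g μ 2)
  map_smul' r f := MemLp.toLp_const_smul (f := (f : X → ℝ)) r (boundedMeasurable.memLp f μ 2)

theorem boundedMeasurable.coeFn_toLp (μ : Measure X) [IsFiniteMeasure μ]
    (f : boundedMeasurable X) : boundedMeasurable.toLp μ f =ᵐ[μ] (f : X → ℝ) :=
  MemLp.coeFn_toLp (boundedMeasurable.memLp f μ 2)

theorem boundedMeasurable.inner_toLp (μ : Measure X) [IsFiniteMeasure μ]
    (f : boundedMeasurable X) (g : Lp ℝ 2 μ) :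
    inner ℝ (boundedMeasurable.toLp μ f) g = ∫ x, (f : X → ℝ) x * g x ∂μ := by
  rw [L2.inner_def]
  refine integral_congr_ae ?_
  filter_upwards [boundedMeasurable.coeFn_toLp μ f] with x hx
  rw [hx]
  simp [mul_comm]

theorem boundedMeasurable.denseRange_toLp (μ : Measure X) [IsFiniteMeasure μ] :
    DenseRange (boundedMeasurable.toLp μ) := by
  refine (Lp.simpleFunc.denseRange (E := ℝ) (p := 2) (μ := μ) (by simp)).mono ?_
  rintro _ ⟨s, rfl⟩
  refine ⟨⟨Lp.simpleFunc.toSimpleFunc s, SimpleFunc.measurable _,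
    SimpleFunc.exists_forall_norm_le (Lp.simpleFunc.toSimpleFunc s)⟩, ?_⟩
  refine Lp.ext ((boundedMeasurable.coeFn_toLp μ _).trans ?_)
  exact Lp.simpleFunc.toSimpleFunc_eq_toFun s

/-- `f` is the weak limit in `L²`, along the filter `p` on the exponents, of the translates of
`h`; both functions are bounded. -/
structure IsLimitOfTranslates {X : Type*} {mX : MeasurableSpace X} (μ : Measure X)
    (T : X ≃ᵐ X) (p : Filter ℤ) (f h : X → ℝ) : Prop where
  measurable : Measurable f
  bounded : ∃ C, ∀ x, |f x| ≤ C
  measurable' : Measurable h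
  bounded' : ∃ C, ∀ x, |h x| ≤ C
  tendsto : ∀ a : X → ℝ, Measurable a → MemLp a 2 μ →
    Tendsto (fun n => ∫ x, h (zpow T n x) * a x ∂μ) p (𝓝 (∫ x, f x * a x ∂μ))

/-- By Mazur's theorem, a weak limit lies in the norm closure of the convex hull of every tail. -/
theorem IsLimitOfTranslates.isRecurrent {μ : Measure X} [IsProbabilityMeasure μ] {T : X ≃ᵐ X}
    (hT : MeasurePreserving T μ μ) {p : Filter ℤ} [p.NeBot] (hp : p ≤ cofinite) {f h : X → ℝ}
    (hfh : IsLimitOfTranslates μ T p f h) :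
    (functionSystem μ T hT).IsRecurrent ⟨f, hfh.measurable, hfh.bounded⟩ := by
  set f' : boundedMeasurable X := ⟨f, hfh.measurable, hfh.bounded⟩
  set h' : boundedMeasurable X := ⟨h, hfh.measurable', hfh.bounded'⟩
  set J := boundedMeasurable.toLp μ
  refine ⟨h', fun K ε hε => ?_⟩
  set U : Set (boundedMeasurable X) :=
    (fun n => (functionSystem μ T hT).act n h') '' (K : Set ℤ)ᶜ
  have hmem : J f' ∈ closure (convexHull ℝ (J '' U)) := by
    by_contra hnot
    obtain ⟨φ, r, h1, h2⟩ := geometric_hahn_banach_closed_point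
      (convex_convexHull ℝ (J '' U)).closure isClosed_closure hnot
    set a : Lp ℝ 2 μ := (InnerProductSpace.toDual ℝ (Lp ℝ 2 μ)).symm φ
    have hφ : ∀ g, φ (J g) = ∫ x, (g : X → ℝ) x * a x ∂μ := by
      intro g
      rw [← boundedMeasurable.inner_toLp, real_inner_comm,
        InnerProductSpace.toDual_symm_apply]
    have hlim := hfh.tendsto a (Lp.stronglyMeasurable a).measurable (Lp.memLp a)
    have hK : ∀ᶠ n in p, n ∉ (K : Set ℤ) := hp K.finite_toSet.compl_mem_cofinite
    have hle : φ (J f') ≤ r := by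
      rw [hφ]
      refine le_of_tendsto hlim ?_
      filter_upwards [hK] with n hn
      have := (h1 _ (subset_closure (subset_convexHull ℝ _
        ⟨_, ⟨n, hn, rfl⟩, rfl⟩))).le
      rwa [hφ] at this
    exact absurd h2 (not_lt.2 hle)
  obtain ⟨v, hv, hdist⟩ := Metric.mem_closure_iff.1 hmem (√ε) (Real.sqrt_pos.2 hε)
  rw [← LinearMap.image_convexHull] at hv
  obtain ⟨w, hw, rfl⟩ := hv
  refine ⟨w, hw, ?_⟩
  have hnorm : (functionSystem μ T hT).integral ((f' - w) * (f' - w)) = ‖J f' - J w‖ ^ 2 := by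
    rw [← map_sub, ← real_inner_self_eq_norm_sq, boundedMeasurable.inner_toLp]
    refine integral_congr_ae ?_
    filter_upwards [boundedMeasurable.coeFn_toLp μ (f' - w)] with x hx
    rw [hx]
    rfl
  rw [hnorm, ← dist_eq_norm]
  calc _ < √ε ^ 2 := pow_lt_pow_left₀ hdist dist_nonneg two_ne_zero
    _ = ε := Real.sq_sqrt hε.le

/-- If the `σ`-algebra of `X` is generated, modulo null sets, by almost everywhere limits of weak
limits of translates, then the system is disjoint from every mixing system. -/
theorem eq_prod_of_generateFrom_limits {μ : Measure X} [IsProbabilityMeasure μ]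
    {T : X ≃ᵐ X} (hT : MeasurePreserving T μ μ) {p : Filter ℤ} [p.NeBot] (hp : p ≤ cofinite)
    {𝓖 : Set (Set X)} (hgen : ‹MeasurableSpace X› = MeasurableSpace.generateFrom 𝓖)
    (h𝓖 : ∀ B ∈ 𝓖, ∃ (F : X → ℝ) (s : Set ℝ), MeasurableSet s ∧ B =ᵐ[μ] F ⁻¹' s ∧
      ∃ f h : ℕ → X → ℝ, (∀ n, IsLimitOfTranslates μ T p (f n) (h n)) ∧
        ∀ᵐ x ∂μ, Tendsto (fun n => f n x) atTop (𝓝 (F x)))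
    {Y : Type*} [MeasurableSpace Y] {ν : Measure Y} [IsProbabilityMeasure ν] {S : Y ≃ᵐ Y}
    (hS : MeasurePreserving S ν ν) (hmix : IsMixing ν S) {ρ : Measure (X × Y)}
    (hρ : IsJoining μ T ν S ρ) :
    ρ = μ.prod ν := by
  refine eq_prod_of_isJoining_of_isMixing hT hgen (fun B hB => ?_) hS hmix hρ
  obtain ⟨F, s, hs, hBF, f, h, hfh, hlim⟩ := h𝓖 B hB
  exact ⟨F, s, hs, hBF, fun n => ⟨f n, (hfh n).measurable, (hfh n).bounded⟩,
    fun n => (hfh n).isRecurrent hT hp, hlim⟩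

end WeakLimits

/-! ### Weak limits of powers of the Koopman operator -/

section Koopman

variable {X : Type*} [mX : MeasurableSpace X] {μ : Measure X} {T : X ≃ᵐ X}

/-- The Koopman operator `f ↦ f ∘ T ^ n`. -/
noncomputable def koopman (hT : MeasurePreserving T μ μ) (n : ℤ) : Lp ℝ 2 μ →ₗᵢ[ℝ] Lp ℝ 2 μ :=
  Lp.compMeasurePreservingₗᵢ ℝ (zpow T n) (measurePreserving_zpow hT n)

theorem coeFn_koopman (hT : MeasurePreserving T μ μ) (n : ℤ) (f : Lp ℝ 2 μ) :
    koopman hT n f =ᵐ[μ] f ∘ zpow T n :=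
  Lp.coeFn_compMeasurePreserving f _

theorem koopman_add (hT : MeasurePreserving T μ μ) (m n : ℤ) (f : Lp ℝ 2 μ) :
    koopman hT (m + n) f = koopman hT n (koopman hT m f) := by
  refine Lp.ext ?_
  filter_upwards [coeFn_koopman hT (m + n) f, coeFn_koopman hT n (koopman hT m f),
    (measurePreserving_zpow hT n).quasiMeasurePreserving.ae (coeFn_koopman hT m f)] with x h1 h2 h3
  rw [h1, h2, Function.comp_apply, Function.comp_apply, h3, zpow_add_apply]
  rfl

theorem koopman_zero (hT : MeasurePreserving T μ μ) (f : Lp ℝ 2 μ) : koopman hT 0 f = f := by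
  refine Lp.ext ?_
  filter_upwards [coeFn_koopman hT 0 f] with x h1
  rw [h1, Function.comp_apply, zpow_zero_apply]

theorem inner_koopman_left (hT : MeasurePreserving T μ μ) (n : ℤ) (f g : Lp ℝ 2 μ) :
    inner ℝ (koopman hT n f) g = inner ℝ f (koopman hT (-n) g) := by
  rw [← LinearIsometry.inner_map_map (koopman hT n) f, ← koopman_add, neg_add_cancel,
    koopman_zero]

/-- `V` is the limit, in the weak operator topology, of the powers of the Koopman operator along
the filter `p`. -/
def IsKoopmanLimit (hT : MeasurePreserving T μ μ) (p : Filter ℤ)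
    (V : Lp ℝ 2 μ →L[ℝ] Lp ℝ 2 μ) : Prop :=
  ∀ f g, Tendsto (fun n => inner ℝ (koopman hT n f) g) p (𝓝 (inner ℝ (V f) g))

theorem exists_isKoopmanLimit (hT : MeasurePreserving T μ μ) (p : Ultrafilter ℤ) :
    ∃ V, IsKoopmanLimit hT p V := by
  have hbd : ∀ n (f g : Lp ℝ 2 μ), |inner ℝ (koopman hT n f) g| ≤ ‖f‖ * ‖g‖ := by
    intro n f g
    have := abs_real_inner_le_norm (koopman hT n f) g
    rwa [LinearIsometry.norm_map] at this
  have h : ∀ f, ∃ l : Lp ℝ 2 μ →ₗ[ℝ] ℝ,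
      ∀ g, Tendsto (fun n => inner ℝ (koopman hT n f) g) p (𝓝 (l g)) := fun f =>
    exists_linearMap_tendsto_ultrafilter p (fun n => innerₗ (Lp ℝ 2 μ) (koopman hT n f))
      fun g => ⟨_, fun n => hbd n f g⟩
  choose l hl using h
  have hlb : ∀ f g, ‖l f g‖ ≤ 1 * ‖f‖ * ‖g‖ := by
    intro f g
    rw [one_mul]
    exact le_of_tendsto (hl f g).norm (Eventually.of_forall fun n => hbd n f g)
  let B : Lp ℝ 2 μ →ₗ[ℝ] Lp ℝ 2 μ →ₗ[ℝ] ℝ :=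
    { toFun := l
      map_add' := fun f f' => LinearMap.ext fun g =>
        tendsto_nhds_unique (hl (f + f') g) (((hl f g).add (hl f' g)).congr fun n => by
          rw [map_add, inner_add_left])
      map_smul' := fun r f => LinearMap.ext fun g =>
        tendsto_nhds_unique (hl (r • f) g) (((hl f g).const_mul r).congr fun n => by
          rw [map_smul, real_inner_smul_left]) }
  refine ⟨InnerProductSpace.continuousLinearMapOfBilin (𝕜 := ℝ)
    (LinearMap.mkContinuous₂ B 1 hlb), fun f g => ?_⟩
  have := InnerProductSpace.continuousLinearMapOfBilin_apply (𝕜 := ℝ)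
    (LinearMap.mkContinuous₂ B 1 hlb) f g
  rw [this]
  exact hl f g

theorem IsKoopmanLimit.map_koopman {hT : MeasurePreserving T μ μ} {p : Filter ℤ} [p.NeBot]
    {V : Lp ℝ 2 μ →L[ℝ] Lp ℝ 2 μ} (hV : IsKoopmanLimit hT p V) (m : ℤ) (f : Lp ℝ 2 μ) :
    V (koopman hT m f) = koopman hT m (V f) := by
  refine ext_inner_right ℝ fun g => ?_
  refine tendsto_nhds_unique (hV _ g) ?_
  rw [inner_koopman_left]
  refine (hV f _).congr fun n => ?_
  rw [← inner_koopman_left, ← koopman_add, ← koopman_add, add_comm]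

/-- A weak limit of powers commutes with `T`, so the `σ`-algebra generated by its image is a
factor. -/
theorem IsKoopmanLimit.isFactor {hT : MeasurePreserving T μ μ} {p : Filter ℤ} [p.NeBot]
    {V : Lp ℝ 2 μ →L[ℝ] Lp ℝ 2 μ} (hV : IsKoopmanLimit hT p V) :
    IsFactor T (imageSigmaAlgebra V) := by
  have hpre : ∀ (n : ℤ) (A : Set X), MeasurableSet[imageSigmaAlgebra V] A →
      MeasurableSet[imageSigmaAlgebra V] (zpow T n ⁻¹' A) := by
    intro n
    have : @Measurable X X (imageSigmaAlgebra V) (imageSigmaAlgebra V) (zpow T n) := by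
      refine @measurable_generateFrom X X (imageSigmaAlgebra V) _ _ ?_
      rintro B ⟨hB, f, s, hs, hBf⟩
      refine MeasurableSpace.measurableSet_generateFrom
        ⟨measurable_zpow T n hB, koopman hT n f, s, hs, ?_⟩
      rw [hV.map_koopman]
      filter_upwards [(measurePreserving_zpow hT n).quasiMeasurePreserving.ae hBf,
        coeFn_koopman hT n (V f)] with x h1 h2
      change (B (zpow T n x)) = (koopman hT n (V f) x ∈ s)
      rw [h2, h1]
      rfl
    exact fun A hA => this hA
  have hone : zpow T 1 = T := funext (zpow_one_apply T)
  refine ⟨MeasurableSpace.generateFrom_le fun B hB => hB.1, fun A => ⟨fun h => ?_, fun h => ?_⟩⟩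
  · have := hpre (-1) _ h
    rw [← hone, ← Set.preimage_comp] at this
    have hcomp : zpow T 1 ∘ zpow T (-1) = id := funext fun x => by
      rw [Function.comp_apply, ← zpow_add_apply, add_neg_cancel, zpow_zero_apply, id]
    rwa [hcomp, Set.preimage_id] at this
  · have := hpre 1 A h
    rwa [hone] at this

theorem measurable_imageSigmaAlgebra (V : Lp ℝ 2 μ →L[ℝ] Lp ℝ 2 μ) (f : Lp ℝ 2 μ) :
    Measurable[imageSigmaAlgebra V] (V f) := fun s hs =>
  MeasurableSpace.measurableSet_generateFrom
    ⟨(Lp.stronglyMeasurable (V f)).measurable hs, f, s, hs, ae_eq_refl _⟩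

theorem ae_trim_of_ae {m : MeasurableSpace X} (hm : m ≤ mX) {P : X → Prop}
    (hP : MeasurableSet[m] {x | P x}) (h : ∀ᵐ x ∂μ, P x) : ∀ᵐ x ∂(μ.trim hm), P x := by
  rw [ae_iff] at h ⊢
  have hP' : MeasurableSet[m] {x | ¬ P x} := @MeasurableSet.compl X _ m hP
  rwa [trim_measurableSet_eq hm hP']

/-- A weak limit of powers is a Markov operator: it preserves upper bounds. -/
theorem IsKoopmanLimit.ae_le [IsProbabilityMeasure μ] {hT : MeasurePreserving T μ μ} {p : Filter ℤ}
    [p.NeBot] {V : Lp ℝ 2 μ →L[ℝ] Lp ℝ 2 μ} (hV : IsKoopmanLimit hT p V) {f : Lp ℝ 2 μ} {C : ℝ}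
    (hf : ∀ᵐ x ∂μ, f x ≤ C) : ∀ᵐ x ∂μ, V f x ≤ C := by
  have hint : ∀ g : Lp ℝ 2 μ, Integrable g μ := fun g => (Lp.memLp g).integrable (by norm_num)
  refine ae_le_of_forall_setIntegral_le (g := fun _ => C) (hint _) (integrable_const C)
    fun s hs hμs => ?_
  have hlim := hV f (indicatorConstLp 2 hs hμs.ne 1)
  rw [real_inner_comm, L2.inner_indicatorConstLp_one] at hlim
  refine le_of_tendsto hlim (Eventually.of_forall fun n => ?_)
  rw [real_inner_comm, L2.inner_indicatorConstLp_one]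
  refine setIntegral_mono_ae (hint _).integrableOn integrableOn_const ?_
  filter_upwards [coeFn_koopman hT n f,
    (measurePreserving_zpow hT n).quasiMeasurePreserving.ae hf] with x h1 h2
  rw [h1]
  exact h2

theorem IsKoopmanLimit.ae_abs_le [IsProbabilityMeasure μ] {hT : MeasurePreserving T μ μ}
    {p : Filter ℤ} [p.NeBot] {V : Lp ℝ 2 μ →L[ℝ] Lp ℝ 2 μ} (hV : IsKoopmanLimit hT p V)
    {f : Lp ℝ 2 μ} {C : ℝ} (hf : ∀ᵐ x ∂μ, |f x| ≤ C) : ∀ᵐ x ∂μ, |V f x| ≤ C := by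
  have h1 := hV.ae_le (hf.mono fun x hx => (abs_le.1 hx).2)
  have h2 : ∀ᵐ x ∂μ, V (-f) x ≤ C := hV.ae_le (by
    filter_upwards [hf, Lp.coeFn_neg f] with x hx hn
    rw [hn, Pi.neg_apply]
    linarith [(abs_le.1 hx).1])
  rw [map_neg] at h2
  filter_upwards [h1, h2, Lp.coeFn_neg (V f)] with x h1 h2 h3
  rw [h3, Pi.neg_apply] at h2
  exact abs_le.2 ⟨by linarith, h1⟩

theorem abs_clamp_le {C : ℝ} (hC : 0 ≤ C) (r : ℝ) : |max (-C) (min C r)| ≤ C :=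
  abs_le.2 ⟨le_max_left _ _, max_le (by linarith) (min_le_left _ _)⟩

theorem clamp_eq_self {C r : ℝ} (h : |r| ≤ C) : max (-C) (min C r) = r := by
  rw [min_eq_right (abs_le.1 h).2, max_eq_right (abs_le.1 h).1]

/-- The automorphism induced by `T` on a factor. -/
def factorEquiv {m : MeasurableSpace X} (hm : IsFactor (mX := mX) T m) :
    @MeasurableEquiv X X m m :=
  @MeasurableEquiv.mk X X m m (@MeasurableEquiv.toEquiv X X mX mX T)
    (fun A hA => (hm.invariant A).2 hA)
    (fun A hA => (hm.invariant _).1 (by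
      have : (@MeasurableEquiv.toEquiv X X mX mX T) ⁻¹'
          ((@MeasurableEquiv.toEquiv X X mX mX T).symm ⁻¹' A) = A := by
        ext x
        simp
      exact this.symm ▸ hA))

/-- Bounded functions in the image of `V` are weak limits of translates also within the factor
generated by `V`: the conditional expectation replaces the function that is translated. -/
theorem IsKoopmanLimit.exists_isLimitOfTranslates [IsProbabilityMeasure μ]
    {hT : MeasurePreserving T μ μ} {p : Filter ℤ} [p.NeBot] {V : Lp ℝ 2 μ →L[ℝ] Lp ℝ 2 μ}
    (hV : IsKoopmanLimit hT p V) (h : boundedMeasurable X) :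
    ∃ f h' : X → ℝ, @IsLimitOfTranslates X (imageSigmaAlgebra V) (μ.trim hV.isFactor.le)
      (factorEquiv hV.isFactor) p f h' ∧ f =ᵐ[μ] V (boundedMeasurable.toLp μ h) := by
  have hm := hV.isFactor.le
  obtain ⟨C, hC⟩ := h.2.2
  have hC0 : 0 ≤ C := by
    obtain ⟨x⟩ := nonempty_of_isProbabilityMeasure μ
    exact (abs_nonneg _).trans (hC x)
  set J := boundedMeasurable.toLp μ h
  have hJ : J =ᵐ[μ] (h : X → ℝ) := boundedMeasurable.coeFn_toLp μ h
  set e : X → ℝ := condExp (imageSigmaAlgebra V) μ h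
  -- Truncation at `C` makes the two functions bounded everywhere; both are so already almost
  -- everywhere, so they change only on null sets.
  set c : ℝ → ℝ := fun r => max (-C) (min C r)
  have hc : Measurable c := measurable_const.max (measurable_const.min measurable_id)
  have hem : Measurable[imageSigmaAlgebra V] (c ∘ e) :=
    hc.comp stronglyMeasurable_condExp.measurable
  have hfm : Measurable[imageSigmaAlgebra V] (c ∘ V J) :=
    hc.comp (measurable_imageSigmaAlgebra V J)
  have hf : c ∘ V J =ᵐ[μ] V J := by
    filter_upwards [hV.ae_abs_le (hJ.mono fun x hx => hx ▸ hC x)] with x hx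
    exact clamp_eq_self hx
  have he : c ∘ e =ᵐ[μ] e := by
    filter_upwards [ae_bdd_abs_condExp_of_ae_bdd_abs (m := imageSigmaAlgebra V)
      (Eventually.of_forall hC : ∀ᵐ x ∂μ, |(h : X → ℝ) x| ≤ C)] with x hx
    exact clamp_eq_self hx
  refine ⟨c ∘ V J, c ∘ e, ⟨hfm, ⟨C, fun x => abs_clamp_le hC0 _⟩, hem,
    ⟨C, fun x => abs_clamp_le hC0 _⟩, fun a ha haL => ?_⟩, hf⟩
  have haL' : MemLp a 2 μ := memLp_of_memLp_trim hm haL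
  set A := haL'.toLp a
  have hA : A =ᵐ[μ] a := haL'.coeFn_toLp
  have hlim : ∫ x, (c ∘ V J) x * a x ∂(μ.trim hm) = inner ℝ (V J) A := by
    refine (integral_trim hm (hfm.mul ha).stronglyMeasurable).symm.trans ?_
    rw [L2.inner_def]
    refine integral_congr_ae ?_
    filter_upwards [hf, hA] with x h1 h2
    rw [Pi.mul_apply, h1, h2]
    simp [mul_comm]
  rw [hlim]
  refine (hV J A).congr fun n => ?_
  have hzm : ∀ k, @Measurable X X (imageSigmaAlgebra V) (imageSigmaAlgebra V) (zpow T k) :=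
    fun k => @measurable_zpow X (imageSigmaAlgebra V) (factorEquiv hV.isFactor) k
  set b : X → ℝ := a ∘ zpow T (-n)
  have hbm : Measurable[imageSigmaAlgebra V] b := ha.comp (hzm (-n))
  have hbL : MemLp b 2 μ := haL'.comp_measurePreserving (measurePreserving_zpow hT (-n))
  have h1 : inner ℝ (koopman hT n J) A = ∫ x, (h : X → ℝ) x * b x ∂μ := by
    rw [inner_koopman_left, boundedMeasurable.inner_toLp]
    refine integral_congr_ae ?_
    filter_upwards [coeFn_koopman hT (-n) A,
      (measurePreserving_zpow hT (-n)).quasiMeasurePreserving.ae hA] with x h1 h2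
    rw [h1, Function.comp_apply, h2]
    rfl
  have h2 : ∫ x, (h : X → ℝ) x * b x ∂μ = ∫ x, (c ∘ e) x * b x ∂μ := by
    have hi : Integrable ((h : X → ℝ) * b) μ := (boundedMeasurable.memLp h μ 2).integrable_mul hbL
    have h3 : ∫ x, ((h : X → ℝ) * b) x ∂μ = _ := (integral_condExp (μ := μ) hm).symm
    refine h3.trans (integral_congr_ae ?_)
    filter_upwards [condExp_mul_of_stronglyMeasurable_right hbm.stronglyMeasurable hi
      (boundedMeasurable.integrable h μ), he] with x h4 h5
    rw [h4, h5]
    rfl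
  have h3 : ∫ x, (c ∘ e) x * b x ∂μ = ∫ x, (c ∘ e) (zpow T n x) * a x ∂μ := by
    refine (integral_comp_zpow hT n
      ((hem.mono hm le_rfl).mul (hbm.mono hm le_rfl))).symm.trans ?_
    refine integral_congr_ae (Eventually.of_forall fun x => ?_)
    simp only [b, Pi.mul_apply, Function.comp_apply, ← zpow_add_apply, neg_add_cancel,
      zpow_zero_apply]
  rw [h1, h2, h3]
  exact integral_trim hm ((hem.comp (hzm n)).mul ha).stronglyMeasurable

/-- The factor generated by a weak limit of powers of `T` is disjoint from every mixing system. -/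
theorem IsKoopmanLimit.disjointFromMixing {X : Type u} [mX : MeasurableSpace X] {μ : Measure X}
    {T : X ≃ᵐ X} [IsProbabilityMeasure μ] {hT : MeasurePreserving T μ μ} {p : Filter ℤ} [p.NeBot]
    (hp : p ≤ cofinite) {V : Lp ℝ 2 μ →L[ℝ] Lp ℝ 2 μ} (hV : IsKoopmanLimit hT p V) :
    DisjointFromMixing.{u, v} μ T (imageSigmaAlgebra V) hV.isFactor := by
  intro Y _ _ ν _ S hS hmix ρ hρ
  have hm := hV.isFactor.le
  have hprob : IsProbabilityMeasure (μ.trim hm) := ⟨by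
    rw [trim_measurableSet_eq hm MeasurableSet.univ, measure_univ]⟩
  have hTm : @MeasurePreserving X X (imageSigmaAlgebra V) (imageSigmaAlgebra V) T (μ.trim hm)
      (μ.trim hm) := by
    have hmeas : @Measurable X X (imageSigmaAlgebra V) (imageSigmaAlgebra V) T :=
      fun A hA => (hV.isFactor.invariant A).2 hA
    refine @MeasurePreserving.mk X X (imageSigmaAlgebra V) (imageSigmaAlgebra V) _ _ _ hmeas
      (@Measure.ext X (imageSigmaAlgebra V) _ _ fun A hA => ?_)
    rw [@Measure.map_apply X X (imageSigmaAlgebra V) (imageSigmaAlgebra V) _ _ hmeas _ hA,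
      trim_measurableSet_eq hm hA, trim_measurableSet_eq hm (hmeas hA)]
    exact hT.measure_preimage (hm _ hA).nullMeasurableSet
  refine @eq_prod_of_generateFrom_limits X (imageSigmaAlgebra V) (μ.trim hm) hprob
    (factorEquiv hV.isFactor) hTm p _ hp _ rfl ?_ Y _ ν _ S hS hmix ρ hρ
  intro B hB
  obtain ⟨-, g, s, hs, hBg⟩ := id hB
  -- Approximate `g` in `L²` by bounded functions
  obtain ⟨h, hh⟩ : ∃ h : ℕ → boundedMeasurable X,
      Tendsto (fun n => boundedMeasurable.toLp μ (h n)) atTop (𝓝 g) := by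
    obtain ⟨u, hu, hug⟩ := mem_closure_iff_seq_limit.1
      (boundedMeasurable.denseRange_toLp μ g)
    choose h hh using hu
    exact ⟨h, by simpa only [hh] using hug⟩
  have hVh : Tendsto (fun n => V (boundedMeasurable.toLp μ (h n))) atTop (𝓝 (V g)) :=
    (V.continuous.tendsto g).comp hh
  obtain ⟨ns, -, hns⟩ := (tendstoInMeasure_of_tendsto_Lp hVh).exists_seq_tendsto_ae
  choose f h' hfh hf using fun n => hV.exists_isLimitOfTranslates (h n)
  refine ⟨V g, s, hs, ?_, fun n => f (ns n), fun n => h' (ns n), fun n => hfh _, ?_⟩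
  · have hBm : MeasurableSet[imageSigmaAlgebra V] B := MeasurableSpace.measurableSet_generateFrom hB
    have hgm : MeasurableSet[imageSigmaAlgebra V] (V g ⁻¹' s) :=
      measurable_imageSigmaAlgebra V g hs
    refine ae_trim_of_ae hm ?_ hBg
    have : {x | B x = (V g ⁻¹' s) x} = (B ∩ V g ⁻¹' s) ∪ (Bᶜ ∩ (V g ⁻¹' s)ᶜ) := by
      ext x
      change (x ∈ B) = (x ∈ V g ⁻¹' s) ↔ _
      simp only [Set.mem_union, Set.mem_inter_iff, Set.mem_compl_iff, eq_iff_iff]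
      tauto
    rw [this]
    exact (hBm.inter hgm).union (hBm.compl.inter hgm.compl)
  · refine ae_trim_of_ae hm ?_ ?_
    · exact @measurableSet_tendsto_fun _ _ _ (imageSigmaAlgebra V) _ _ _ _ _ _ _ _ _
        (fun n => (hfh (ns n)).measurable) _ (measurable_imageSigmaAlgebra V g)
    · filter_upwards [hns, ae_all_iff.2 hf] with x h1 h2
      simpa only [h2] using h1

end Koopman

/-! ### Limits of graph joinings and non-mixing automorphisms -/

section Indicators

variable {X : Type*} [MeasurableSpace X] {μ : Measure X} [IsProbabilityMeasure μ]

theorem continuousLinearMap_eq_zero_of_indicator {E : Type*} [NormedAddCommGroup E]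
    [NormedSpace ℝ E] (L : Lp ℝ 2 μ →L[ℝ] E)
    (h : ∀ (A : Set X) (hA : MeasurableSet A),
      L (indicatorConstLp 2 hA (measure_ne_top μ A) 1) = 0) : L = 0 := by
  ext f
  refine Lp.induction (p := 2) (by simp) (fun f => L f = (0 : Lp ℝ 2 μ →L[ℝ] E) f) ?_ ?_ ?_ f
  · intro c s hs hμs
    rw [Lp.simpleFunc.coe_indicatorConst]
    have : indicatorConstLp 2 hs hμs.ne c = c • indicatorConstLp 2 hs hμs.ne (1 : ℝ) := by
      refine Lp.ext ?_
      filter_upwards [indicatorConstLp_coeFn (p := 2) (hs := hs) (hμs := hμs.ne) (c := c),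
        indicatorConstLp_coeFn (p := 2) (hs := hs) (hμs := hμs.ne) (c := (1 : ℝ)),
        Lp.coeFn_smul c (indicatorConstLp 2 hs hμs.ne (1 : ℝ))] with x h1 h2 h3
      rw [h1, h3, Pi.smul_apply, h2]
      by_cases hx : x ∈ s <;> simp [hx]
    rw [this, map_smul, h s hs, smul_zero]
    rfl
  · intro f g hf hg _ h1 h2
    rw [map_add, h1, h2, map_add]
  · exact isClosed_eq L.continuous (0 : Lp ℝ 2 μ →L[ℝ] E).continuous

theorem continuousLinearMap_ext_indicator {Y : Type*} [MeasurableSpace Y] {ν : Measure Y}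
    [IsProbabilityMeasure ν] {V W : Lp ℝ 2 μ →L[ℝ] Lp ℝ 2 ν}
    (h : ∀ (A : Set X) (B : Set Y) (hA : MeasurableSet A) (hB : MeasurableSet B),
      inner ℝ (V (indicatorConstLp 2 hA (measure_ne_top μ A) 1))
        (indicatorConstLp 2 hB (measure_ne_top ν B) (1 : ℝ))
      = inner ℝ (W (indicatorConstLp 2 hA (measure_ne_top μ A) 1))
        (indicatorConstLp 2 hB (measure_ne_top ν B) (1 : ℝ))) : V = W := by
  rw [← sub_eq_zero]
  refine continuousLinearMap_eq_zero_of_indicator _ fun A hA => ?_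
  set v := (V - W) (indicatorConstLp 2 hA (measure_ne_top μ A) 1)
  have hv : innerSL ℝ v = 0 := by
    refine continuousLinearMap_eq_zero_of_indicator _ fun B hB => ?_
    change inner ℝ (V _ - W _) _ = 0
    rw [inner_sub_left, h A B hA hB, sub_self]
  have := congrArg (fun L => L v) hv
  simpa using this

theorem inner_koopman_indicator {T : X ≃ᵐ X} (hT : MeasurePreserving T μ μ) (n : ℤ) {A B : Set X}
    (hA : MeasurableSet A) (hB : MeasurableSet B) :
    inner ℝ (koopman hT n (indicatorConstLp 2 hA (measure_ne_top μ A) 1))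
      (indicatorConstLp 2 hB (measure_ne_top μ B) (1 : ℝ)) = μ.real (B ∩ zpow T n ⁻¹' A) := by
  have hA' : MeasurableSet (zpow T n ⁻¹' A) := measurable_zpow T n hA
  rw [real_inner_comm, L2.inner_indicatorConstLp_one]
  have : koopman hT n (indicatorConstLp 2 hA (measure_ne_top μ A) 1)
      =ᵐ[μ] (zpow T n ⁻¹' A).indicator 1 := by
    filter_upwards [coeFn_koopman hT n (indicatorConstLp 2 hA (measure_ne_top μ A) 1),
      (measurePreserving_zpow hT n).quasiMeasurePreserving.ae
        (indicatorConstLp_coeFn (p := 2) (hs := hA) (hμs := measure_ne_top μ A) (c := (1 : ℝ)))]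
      with x h1 h2
    rw [h1, Function.comp_apply, h2]
    rfl
  rw [integral_congr_ae (ae_restrict_of_ae this), integral_indicator_one hA',
    measureReal_restrict_apply hA', Set.inter_comm]

/-- The Markov operator of a limit of graph joinings is a weak limit of powers of the Koopman
operator. -/
theorem exists_isKoopmanLimit_markovOperator {T : X ≃ᵐ X} (hT : MeasurePreserving T μ μ)
    {ρ : Measure (X × X)} (hρ : IsJoining μ T μ T ρ) {k : ℕ → ℤ}
    (hk : Tendsto (fun j => |k j|) atTop atTop)
    (hlim : WeakLimit (fun j => graphJoining μ T (k j)) ρ) :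
    ∃ p : Ultrafilter ℤ, (p : Filter ℤ) ≤ cofinite ∧ IsKoopmanLimit hT p (markovOperator hρ) := by
  have := hρ.isProbabilityMeasure
  -- `⟨V f, g⟩ = lim ⟨f, g ∘ T ^ k⟩ = lim ⟨f ∘ T ^ (-k), g⟩`, whence the sign
  set p := Ultrafilter.of (map (fun j => -k j) atTop)
  have hp : (p : Filter ℤ) ≤ map (fun j => -k j) atTop := Ultrafilter.of_le _
  obtain ⟨V, hV⟩ := exists_isKoopmanLimit hT p
  have hVM : V = markovOperator hρ := by
    refine continuousLinearMap_ext_indicator fun A B hA hB => ?_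
    have h1 : Tendsto (fun n : ℤ => μ.real (B ∩ zpow T n ⁻¹' A)) p (𝓝 (ρ.real (A ×ˢ B))) := by
      refine Tendsto.mono_left ?_ hp
      rw [tendsto_map'_iff]
      refine ((ENNReal.tendsto_toReal (measure_ne_top _ _)).comp (hlim A B hA hB)).congr fun j => ?_
      rw [Function.comp_apply, graphJoining_prod μ T _ hA hB, Function.comp_apply,
        ← (measurePreserving_zpow hT (k j)).measureReal_preimage
          (hB.inter (measurable_zpow T _ hA)).nullMeasurableSet]
      change μ.real _ = _
      congr 1
      ext x
      simp only [Set.mem_inter_iff, Set.mem_preimage, ← zpow_add_apply, neg_add_cancel,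
        zpow_zero_apply]
      exact and_comm
    refine (tendsto_nhds_unique (hV _ _)
      (h1.congr fun n => (inner_koopman_indicator hT n hA hB).symm)).trans ?_
    rw [inner_markovOperator]
    have h2 : (fun q : X × X =>
        (indicatorConstLp 2 hA (measure_ne_top μ A) (1 : ℝ) : Lp ℝ 2 μ) q.1 *
        (indicatorConstLp 2 hB (measure_ne_top μ B) (1 : ℝ) : Lp ℝ 2 μ) q.2)
        =ᵐ[ρ] (A ×ˢ B).indicator 1 := by
      filter_upwards [hρ.fst.quasiMeasurePreserving.ae
          (indicatorConstLp_coeFn (p := 2) (hs := hA) (hμs := measure_ne_top μ A) (c := (1 : ℝ))),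
        hρ.snd.quasiMeasurePreserving.ae
          (indicatorConstLp_coeFn (p := 2) (hs := hB) (hμs := measure_ne_top μ B) (c := (1 : ℝ)))]
        with q h1 h2
      rw [h1, h2]
      by_cases hqA : q.1 ∈ A <;> by_cases hqB : q.2 ∈ B <;> simp [Set.indicator, hqA, hqB]
    rw [integral_congr_ae h2, integral_indicator_one (hA.prod hB)]
  refine ⟨p, hp.trans ?_, hVM ▸ hV⟩
  rw [le_cofinite_iff_eventually_ne]
  intro m
  rw [eventually_map]
  filter_upwards [hk.eventually_gt_atTop |m|] with j hj heq
  rw [← heq, abs_neg] at hj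
  exact lt_irrefl _ hj

/-- An automorphism that is not mixing has a weak limit of powers whose image is not contained in
the constants. -/
theorem exists_isKoopmanLimit_nontrivial {T : X ≃ᵐ X} (hT : MeasurePreserving T μ μ)
    (hmix : ¬ IsMixing μ T) :
    ∃ (p : Ultrafilter ℤ) (V : Lp ℝ 2 μ →L[ℝ] Lp ℝ 2 μ), (p : Filter ℤ) ≤ cofinite ∧
      IsKoopmanLimit hT p V ∧
      ∃ A, MeasurableSet[imageSigmaAlgebra V] A ∧ μ A ≠ 0 ∧ μ A ≠ 1 := by
  simp only [IsMixing, not_forall] at hmix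
  obtain ⟨A, B, hA, hB, hnot⟩ := hmix
  rw [tendsto_iff_ultrafilter] at hnot
  push Not at hnot
  obtain ⟨q, hq, hnot⟩ := hnot
  set p : Ultrafilter ℤ := q.map (Nat.cast : ℕ → ℤ)
  obtain ⟨V, hV⟩ := exists_isKoopmanLimit hT p
  refine ⟨p, V, ?_, hV, ?_⟩
  · change Tendsto (Nat.cast : ℕ → ℤ) q cofinite
    rw [← Nat.cofinite_eq_atTop] at hq
    exact (Nat.cast_injective.tendsto_cofinite).mono_left hq
  by_contra! htriv
  set v := V (indicatorConstLp 2 hB (measure_ne_top μ B) 1)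
  -- If the factor were trivial, `v` would be constant, and `q` would not detect the lack of mixing.
  obtain ⟨c, hc⟩ : ∃ c, v =ᵐ[μ] Function.const X c := by
    refine exists_eventuallyEq_const_of_forall_separating MeasurableSet fun U hU => ?_
    have hUm : MeasurableSet[imageSigmaAlgebra V] (v ⁻¹' U) :=
      measurable_imageSigmaAlgebra V _ hU
    have hUm' : MeasurableSet (v ⁻¹' U) := (Lp.stronglyMeasurable v).measurable hU
    by_cases h0 : μ (v ⁻¹' U) = 0
    · exact Or.inr (measure_eq_zero_iff_ae_notMem.1 h0)
    · exact Or.inl ((mem_ae_iff_prob_eq_one hUm').2 (htriv _ hUm h0))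
  have hlim : ∀ D, MeasurableSet D →
      Tendsto (fun n : ℕ => μ.real (D ∩ T^[n] ⁻¹' B)) q (𝓝 (c * μ.real D)) := by
    intro D hD
    have h1 := (hV (indicatorConstLp 2 hB (measure_ne_top μ B) 1)
      (indicatorConstLp 2 hD (measure_ne_top μ D) 1)).comp
      (tendsto_map : Tendsto (Nat.cast : ℕ → ℤ) q p)
    have h2 : inner ℝ v (indicatorConstLp 2 hD (measure_ne_top μ D) (1 : ℝ)) = c * μ.real D := by
      rw [real_inner_comm, L2.inner_indicatorConstLp_one, integral_congr_ae (ae_restrict_of_ae hc)]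
      simp [mul_comm]
    rw [h2] at h1
    refine h1.congr fun n => ?_
    rw [Function.comp_apply, inner_koopman_indicator hT n hB hD, zpow_natCast]
  have hcB : c = μ.real B := by
    have h1 := hlim Set.univ .univ
    simp only [Set.univ_inter, probReal_univ, mul_one] at h1
    refine tendsto_nhds_unique h1 (tendsto_const_nhds.congr fun n => ?_)
    exact ((hT.iterate n).measureReal_preimage hB.nullMeasurableSet).symm
  refine hnot ?_
  have h1 := ENNReal.tendsto_ofReal (hlim A hA)
  simp only [measureReal_def] at h1
  rw [hcB, mul_comm, measureReal_def, ← ENNReal.toReal_mul,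
    ENNReal.ofReal_toReal (by finiteness)] at h1
  exact h1.congr fun n => ENNReal.ofReal_toReal (measure_ne_top _ _)

end Indicators

end Joinings

theorem mainTheorem1 {X : Type u} [MeasurableSpace X] [StandardBorelSpace X]
    (μ : Measure X) [IsProbabilityMeasure μ] (T : X ≃ᵐ X) (hT : MeasurePreserving T μ μ) :
    (∀ (ρ : Measure (X × X)) (hρ : Joinings.IsJoining μ T μ T ρ) (k : ℕ → ℤ),
      Tendsto (fun j => |k j|) atTop atTop →
      Joinings.WeakLimit (fun j => Joinings.graphJoining μ T (k j)) ρ →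
      ∃ hm : Joinings.IsFactor T (Joinings.generatedFactor hρ),
        Joinings.DisjointFromMixing.{u, v} μ T (Joinings.generatedFactor hρ) hm) ∧
    (¬ Joinings.IsMixing μ T →
      ∃ (m : MeasurableSpace X) (hm : Joinings.IsFactor T m),
        (∃ A : Set X, MeasurableSet[m] A ∧ μ A ≠ 0 ∧ μ A ≠ 1) ∧
        Joinings.DisjointFromMixing.{u, v} μ T m hm) := by
  refine ⟨fun ρ hρ k hk hlim => ?_, fun hmix => ?_⟩
  · obtain ⟨p, hp, hV⟩ := Joinings.exists_isKoopmanLimit_markovOperator hT hρ hk hlim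
    exact ⟨hV.isFactor, hV.disjointFromMixing hp⟩
  · obtain ⟨p, V, hp, hV, hA⟩ := Joinings.exists_isKoopmanLimit_nontrivial hT hmix
    exact ⟨Joinings.imageSigmaAlgebra V, hV.isFactor, hA, hV.disjointFromMixing hp⟩
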